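/- Let $\mu_0>0$ and $x_0\in\mathbb{R}$. A permittivity is a function $\varepsilon:\mathbb{R}\to\mathbb{C}$ that is piecewise smooth (finitely many breakpoints on bounded intervals, each piece smooth up to its end points), satisfies $\mathrm{Re}\,\varepsilon>0$ and $\varepsilon(x+1)=\varepsilon(x)$, and is inversion symmetric in the unit cell: $\varepsilon(x_0+h)=\varepsilon(x_0+1-h)$ for $h\in(0,1)$. Write $\mathcal{L}_\varepsilon u=-\frac1{\mu_0}\big(\frac1\varepsilon u'\big)'$; solutions of $\mathcal{L}_\varepsilon u=\omega^2u$ are continuous with continuous flux $\frac1\varepsilon u'$. The Floquet–Bloch spectrum of $\varepsilon$ is the set of $\omega\in\mathbb{C}$ for which $\mathcal{L}_\varepsilon u=\omega^2u$ has a nonzero solution with $u(x+1)=e^{i\kappa}u(x)$ and $u'(x+1)=e^{i\kappa}u'(x)$ for some $\kappa\in[-\pi,\pi]$. Given permittivities $\varepsilon_A$ (material on the left of $x_0$) and $\varepsilon_B$ (material on the right), the common band gap region $\mathfrak{A}\subset\mathbb{C}$ is the set of $\omega$ in neither Floquet–Bloch spectrum. For $\omega\in\mathfrak{A}$ the interface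 impedance is $$Z(\omega)=Z_A(\omega)+Z_B(\omega),\qquad Z_A(\omega)=-\frac{u_A(x_0^-)}{\frac{1}{\varepsilon_A(x_0^-)}u_A'(x_0^-)},\qquad Z_B(\omega)=\frac{u_B(x_0^+)}{\frac{1}{\varepsilon_B(x_0^+)}u_B'(x_0^+)},$$ where $u_A$ (resp. $u_B$) is a nonzero solution of $\mathcal{L}_{\varepsilon_A}u=\omega^2u$ (resp. $\mathcal{L}_{\varepsilon_B}u=\omega^2u$) that decays together with its derivative as $x\to-\infty$ (resp. $x\to+\infty$). A point where one of the denominators vanishes is a pole, not a root, of $Z$. Let $\varepsilon_A^U,\varepsilon_B^U$ be real-valued permittivities (the undamped materials). For small $\delta>0$ let $\varepsilon_A^{\delta},\varepsilon_B^{\delta}$ be permittivities (the damped materials) with $\mathrm{Re}\,\varepsilon_j^{\delta}=\varepsilon_j^U$ and $$\lim_{\delta\to0}\ \sup_{x\in\mathbb{R}}|\mathrm{Im}\,\varepsilon_j^{\delta}(x)|=0,\qquad j=A,B.$$ Let $\mathfrak{A}^U,Z^{(U)}$ and $\mathfrak{A}^D=\mathfrak{A}^D(\delta),Z^{(D)}=Z^{(D)}_\delta$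 be the corresponding common band gap regions and interface impedances. Theorem. Let $\omega_U\in\mathfrak{A}^U$ be a root of $Z^{(U)}$. Then there are $\rho>0$ and frequencies $\omega_D(\delta)\in\mathbb{C}$ with $\omega_D(\delta)\to\omega_U$ as $\delta\to0^+$ such that, for all sufficiently small $\delta>0$: $\omega_U\in\mathfrak{A}^D(\delta)$; $\omega_D(\delta)$ lies in the connected component of $\mathfrak{A}^D(\delta)$ that contains $\omega_U$; $Z^{(D)}_\delta(\omega_D(\delta))=0$; and $\omega_D(\delta)$ is the only root of $Z^{(D)}_\delta$ in $\{\omega\in\mathfrak{A}^D(\delta):|\omega-\omega_U|<\rho\}$. -/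

import Mathlib

open Filter Topology Set

namespace DampedInterface

/-- `f` is piecewise smooth: on each side of every point it coincides, near the point, with a
smooth function defined across the point. By compactness, on every bounded interval there are
finitely many breakpoints, and `f` is smooth up to the end points on each piece. The values at the
breakpoints are arbitrary. -/
def PiecewiseSmooth (f : ℝ → ℂ) : Prop :=
  ∀ x : ℝ, ∃ g h : ℝ → ℂ, ContDiff ℝ (⊤ : ℕ∞) g ∧ ContDiff ℝ (⊤ : ℕ∞) h ∧
    f =ᶠ[𝓝[<] x] g ∧ f =ᶠ[𝓝[>] x] h

/-- The standing assumptions on the permittivity of a periodic material whose unit cells are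
`[x₀ + n, x₀ + n + 1]`. -/
structure IsPermittivity (x₀ : ℝ) (ε : ℝ → ℂ) : Prop where
  piecewiseSmooth : PiecewiseSmooth ε
  re_pos : ∀ x, 0 < (ε x).re
  periodic : ∀ x, ε (x + 1) = ε x
  inversion_symmetric : ∀ h ∈ Ioo (0 : ℝ) 1, ε (x₀ + h) = ε (x₀ + 1 - h)

/-- `u` solves `-(1/μ₀) ((1/ε) u')' = ω² u` on the real line, with flux `p = (1/ε) u'`. Both `u` and
the flux are continuous (the transmission conditions at the jumps of `ε`), `u' = ε p` at every
point where `ε` is continuous, and `p' = -μ₀ ω² u`. -/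
structure IsSolution (μ₀ : ℝ) (ε : ℝ → ℂ) (ω : ℂ) (u p : ℝ → ℂ) : Prop where
  continuous_u : Continuous u
  continuous_flux : Continuous p
  hasDerivAt_u : ∀ x, ContinuousAt ε x → HasDerivAt u (ε x * p x) x
  hasDerivAt_flux : ∀ x, HasDerivAt p (-(μ₀ : ℂ) * ω ^ 2 * u x) x

/-- The Floquet-Bloch spectrum (the union of the spectral bands, in the frequency plane) of the
periodic material `ε`: the frequencies having a nonzero solution `u` such that `u` and its flux are
quasiperiodic with some quasimomentum `κ ∈ [-π, π]`. As `ε` is periodic, quasiperiodicity of the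
flux amounts to that of `u'`. -/
def blochSpectrum (μ₀ : ℝ) (ε : ℝ → ℂ) : Set ℂ :=
  {ω | ∃ κ ∈ Icc (-Real.pi) Real.pi, ∃ u p : ℝ → ℂ, IsSolution μ₀ ε ω u p ∧ u ≠ 0 ∧
    (∀ x, u (x + 1) = Complex.exp (Complex.I * κ) * u x) ∧
    (∀ x, p (x + 1) = Complex.exp (Complex.I * κ) * p x)}

/-- The common band gap region of two periodic materials: the frequencies that lie in neither of the
two Floquet-Bloch spectra. -/
def commonGap (μ₀ : ℝ) (εA εB : ℝ → ℂ) : Set ℂ :=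
  (blochSpectrum μ₀ εA)ᶜ ∩ (blochSpectrum μ₀ εB)ᶜ

/-- A nonzero solution which decays, together with its flux, along the filter `l`
(`atBot` for `x → -∞`, `atTop` for `x → +∞`). -/
structure IsDecayingSolution (μ₀ : ℝ) (ε : ℝ → ℂ) (ω : ℂ) (l : Filter ℝ) (u p : ℝ → ℂ) :
    Prop where
  isSolution : IsSolution μ₀ ε ω u p
  ne_zero : u ≠ 0
  tendsto_u : Tendsto u l (𝓝 0)
  tendsto_flux : Tendsto p l (𝓝 0)

/-- `z = u(x₀) / ((1/ε) u')(x₀)` for a solution `u` decaying along `l`, the denominator being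
nonzero. -/
def IsRatio (μ₀ : ℝ) (ε : ℝ → ℂ) (x₀ : ℝ) (l : Filter ℝ) (ω z : ℂ) : Prop :=
  ∃ u p : ℝ → ℂ, IsDecayingSolution μ₀ ε ω l u p ∧ p x₀ ≠ 0 ∧ z = u x₀ / p x₀

open Classical in
/-- The ratio `u(x₀) / ((1/ε) u')(x₀)` of the solution decaying along `l`, with values in
`ℂ ∪ {∞}`. It is `∞` where the denominator vanishes (a pole); for definiteness it is also `∞` where
there is no decaying solution, which does not happen in a band gap. It does not depend on the choice
of the solution, see `isRatio_unique`. -/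
noncomputable def ratio (μ₀ : ℝ) (ε : ℝ → ℂ) (x₀ : ℝ) (l : Filter ℝ) (ω : ℂ) : OnePoint ℂ :=
  if h : ∃ z : ℂ, IsRatio μ₀ ε x₀ l ω z then ((h.choose : ℂ) : OnePoint ℂ) else OnePoint.infty

/-- The surface impedance `Z_A = -u_A(x₀⁻) / ((1/ε_A) u_A')(x₀⁻)` of the left material, where `u_A`
decays at `-∞`. -/
noncomputable def surfaceImpedanceA (μ₀ : ℝ) (εA : ℝ → ℂ) (x₀ : ℝ) (ω : ℂ) : OnePoint ℂ :=
  OnePoint.map (fun z : ℂ => -z) (ratio μ₀ εA x₀ atBot ω)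

/-- The surface impedance `Z_B = u_B(x₀⁺) / ((1/ε_B) u_B')(x₀⁺)` of the right material, where `u_B`
decays at `+∞`. -/
noncomputable def surfaceImpedanceB (μ₀ : ℝ) (εB : ℝ → ℂ) (x₀ : ℝ) (ω : ℂ) : OnePoint ℂ :=
  ratio μ₀ εB x₀ atTop ω

/-- The interface impedance `Z = Z_A + Z_B`; it is `∞` if one of the two summands is `∞`. -/
noncomputable def interfaceImpedance (μ₀ : ℝ) (εA εB : ℝ → ℂ) (x₀ : ℝ) (ω : ℂ) : OnePoint ℂ :=
  Option.map₂ (fun a b : ℂ => a + b)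
    (surfaceImpedanceA μ₀ εA x₀ ω) (surfaceImpedanceB μ₀ εB x₀ ω)

lemma PiecewiseSmooth.countable {f : ℝ → ℂ} (hf : PiecewiseSmooth f) :
    {x | ¬ ContinuousAt f x}.Countable := by
  have key : ∀ x : ℝ, ∃ U ∈ 𝓝 x, ∀ y ∈ U, y ≠ x → ContinuousAt f y := by
    intro x
    obtain ⟨g, h, hg, hh, h1, h2⟩ := hf x
    have e1 : ∀ᶠ y in 𝓝[<] x, ContinuousAt f y := by
      have := eventually_eventually_nhdsWithin.2 h1
      filter_upwards [this, self_mem_nhdsWithin] with y hy hyx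
      rw [IsOpen.nhdsWithin_eq isOpen_Iio hyx] at hy
      exact (hg.continuous.continuousAt).congr_of_eventuallyEq hy
    have e2 : ∀ᶠ y in 𝓝[>] x, ContinuousAt f y := by
      have := eventually_eventually_nhdsWithin.2 h2
      filter_upwards [this, self_mem_nhdsWithin] with y hy hyx
      rw [IsOpen.nhdsWithin_eq isOpen_Ioi hyx] at hy
      exact (hh.continuous.continuousAt).congr_of_eventuallyEq hy
    have e3 : ∀ᶠ y in 𝓝[≠] x, ContinuousAt f y := by
      rw [← Iio_union_Ioi, nhdsWithin_union]
      exact eventually_sup.2 ⟨e1, e2⟩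
    exact ⟨_, eventually_nhdsWithin_iff.1 e3, fun y hy hyx => hy hyx⟩
  choose U hU hc using key
  obtain ⟨s, hs, hsU⟩ := TopologicalSpace.countable_cover_nhds hU
  refine hs.mono fun y hy => ?_
  have hyU : y ∈ ⋃ x ∈ s, U x := by rw [hsU]; trivial
  obtain ⟨x, hxs, hyx⟩ := mem_iUnion₂.1 hyU
  by_cases h : y = x
  · exact h ▸ hxs
  · exact absurd (hc x y hyx h) hy

/-- The Wronskian of two solutions is constant. -/
lemma IsSolution.wronskian_const {μ₀ : ℝ} {ε : ℝ → ℂ} {ω : ℂ} {u p v q : ℝ → ℂ}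
    (hε : PiecewiseSmooth ε) (hu : IsSolution μ₀ ε ω u p) (hv : IsSolution μ₀ ε ω v q) (a b : ℝ) :
    u a * q a - v a * p a = u b * q b - v b * p b := by
  have hcont : Continuous fun x => u x * q x - v x * p x :=
    (hu.continuous_u.mul hv.continuous_flux).sub (hv.continuous_u.mul hu.continuous_flux)
  have h := MeasureTheory.integral_eq_of_hasDerivAt_off_countable
    (fun x => u x * q x - v x * p x) (fun _ => (0 : ℂ)) (a := a) (b := b) hε.countable
    hcont.continuousOn (by
      intro x hx
      have hx' : ContinuousAt ε x := by simpa using hx.2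
      have := ((hu.hasDerivAt_u x hx').mul (hv.hasDerivAt_flux x)).sub
        ((hv.hasDerivAt_u x hx').mul (hu.hasDerivAt_flux x))
      exact this.congr_deriv (by ring)) (by simp)
  simp only [intervalIntegral.integral_zero] at h
  exact (sub_eq_zero.1 h.symm).symm

/-- The ratio does not depend on the choice of the decaying solution. -/
lemma isRatio_unique {μ₀ : ℝ} {ε : ℝ → ℂ} (hε : PiecewiseSmooth ε) {x₀ : ℝ} {l : Filter ℝ}
    [l.NeBot] {ω z w : ℂ} (hz : IsRatio μ₀ ε x₀ l ω z) (hw : IsRatio μ₀ ε x₀ l ω w) : z = w := by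
  obtain ⟨u, p, hu, hp, rfl⟩ := hz
  obtain ⟨v, q, hv, hq, rfl⟩ := hw
  have h0 : Tendsto (fun x => u x * q x - v x * p x) l (𝓝 0) := by
    simpa using (hu.tendsto_u.mul hv.tendsto_flux).sub (hv.tendsto_u.mul hu.tendsto_flux)
  have h1 : u x₀ * q x₀ - v x₀ * p x₀ = 0 := by
    refine tendsto_nhds_unique (Tendsto.congr (fun x => ?_) tendsto_const_nhds) h0
    exact IsSolution.wronskian_const hε hu.isSolution hv.isSolution x₀ x
  rw [div_eq_div_iff hp hq]
  linear_combination h1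

end DampedInterface

/-! Put `r` for the value at `x₀` of the mode decaying at `+∞`, normalized to unit flux there.
Inversion symmetry makes the mode decaying at `-∞` its reflection, with the flux reversed, so `Z =
r_A + r_B` (`interfaceImpedance_eq`). The monodromy matrix has determinant one and equal diagonal
entries `a`. A frequency lies in a gap exactly when `z² - 2az + 1` has a root inside the unit disc,
and then the flux at `x₀` cannot vanish: there are no poles in a gap.

The modes depend continuously on permittivity and frequency jointly
(`IsDecayingMode.exists_perturbation`), so a ball around `ωU`, of radius independent of `δ`, stays
in the damped gaps. Instead of differentiating `Z`, the Wronskian gives the exact increment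
(`IsDecayingMode.sub_eq`): `r(ω) - r(ω') = -μ₀ (ω² - ω'²) ∫ u_ω u_ω'` over the half-line.

Applied to a mode and its conjugate, this formula forces `ωU²` to be real at a root
(`sq_conj_eq_of_root`). The undamped modes are then real, their couplings `n_A`, `n_B` are positive,
and the difference quotients of the damped `Z` tend to `L = -2 μ₀ ωU (n_A + n_B)`, which is nonzero
because `ωU ≠ 0`. Near `ωU` the damped impedance is thus uniformly close to linear with slope `L`,
and tends to zero at `ωU`. The quantitative inverse function theorem yields a root, and expansion
yields uniqueness and convergence. -/

namespace DampedInterface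

/-! ### Linear differential equations with bounded measurable coefficients -/

lemma norm_integral_exp_abs_le {K : ℝ} (hK : 0 < K) (x₀ x : ℝ) :
    |∫ s in x₀..x, Real.exp (K * |s - x₀|)| ≤ Real.exp (K * |x - x₀|) / K := by
  have hpos : ∀ t : ℝ, 0 ≤ t →
      |∫ s in (0 : ℝ)..t, Real.exp (K * |s|)| ≤ Real.exp (K * t) / K := by
    intro t ht
    have h1 : ∫ s in (0 : ℝ)..t, Real.exp (K * |s|) = ∫ s in (0 : ℝ)..t, Real.exp (K * s) := by
      refine intervalIntegral.integral_congr fun s hs => ?_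
      rw [uIcc_of_le ht] at hs
      simp only [abs_of_nonneg hs.1]
    rw [h1, intervalIntegral.integral_comp_mul_left (fun s => Real.exp s) hK.ne', integral_exp]
    have h2 : 1 ≤ Real.exp (K * t) := Real.one_le_exp (by positivity)
    rw [mul_zero, Real.exp_zero, smul_eq_mul, abs_of_nonneg
      (mul_nonneg (by positivity) (by linarith)), div_eq_inv_mul]
    have : 0 < K⁻¹ := by positivity
    nlinarith
  have h0 : ∫ s in x₀..x, Real.exp (K * |s - x₀|)
      = ∫ s in (0 : ℝ)..(x - x₀), Real.exp (K * |s|) := by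
    rw [intervalIntegral.integral_comp_sub_right (fun s => Real.exp (K * |s|)), sub_self]
  rw [h0]
  rcases le_total 0 (x - x₀) with h | h
  · rw [abs_of_nonneg h]; exact hpos _ h
  · have h3 := hpos (-(x - x₀)) (by linarith)
    have h4 : ∫ s in (0 : ℝ)..(-(x - x₀)), Real.exp (K * |s|)
        = -∫ s in (0 : ℝ)..(x - x₀), Real.exp (K * |s|) := by
      have := intervalIntegral.integral_comp_neg (a := 0) (b := x - x₀)
        (fun s => Real.exp (K * |s|))
      simp only [abs_neg, neg_zero] at this
      rw [this, intervalIntegral.integral_symm]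
    rw [h4, abs_neg] at h3
    rwa [abs_of_nonpos h]

section LinearODE

variable {F : Type*} [NormedAddCommGroup F] [NormedSpace ℝ F]

lemma intervalIntegrable_clm_apply {A : ℝ → F →L[ℝ] F}
    (hA : MeasureTheory.AEStronglyMeasurable A MeasureTheory.volume) {M : ℝ}
    (hM : ∀ s, ‖A s‖ ≤ M) {y : ℝ → F} (hy : Continuous y) (a b : ℝ) :
    IntervalIntegrable (fun s => A s (y s)) MeasureTheory.volume a b := by
  have hmeas : MeasureTheory.AEStronglyMeasurable (fun s => A s (y s)) MeasureTheory.volume :=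
    (ContinuousLinearMap.apply ℝ F).flip.aestronglyMeasurable_comp₂ hA hy.aestronglyMeasurable
  have hi : IntervalIntegrable (fun s => M * ‖y s‖) MeasureTheory.volume a b :=
    (hy.norm.const_mul M |>.intervalIntegrable a b)
  refine hi.mono_fun' hmeas.restrict (Filter.Eventually.of_forall fun s => ?_)
  exact (A s).le_of_opNorm_le (hM s) _

/-- Integrating the weight of rate `2M` gains `1/(2M)` against the factor `M` from the coefficient.
The resulting `1/2` is the contraction constant of the weighted Picard map. -/
lemma norm_integral_exp_smul_le {A : ℝ → F →L[ℝ] F} {M : ℝ} (hM0 : 0 < M)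
    (hM : ∀ s, ‖A s‖ ≤ M) (x₀ : ℝ) {w : ℝ → F} {R : ℝ} (hw : ∀ s, ‖w s‖ ≤ R) (x : ℝ) :
    ‖Real.exp (-(2 * M * |x - x₀|)) •
      ∫ s in x₀..x, A s (Real.exp (2 * M * |s - x₀|) • w s)‖ ≤ R / 2 := by
  have hR : 0 ≤ R := (norm_nonneg _).trans (hw x₀)
  have h1 : ‖∫ s in x₀..x, A s (Real.exp (2 * M * |s - x₀|) • w s)‖
      ≤ |∫ s in x₀..x, M * R * Real.exp (2 * M * |s - x₀|)| := by
    refine intervalIntegral.norm_integral_le_abs_of_norm_le (Filter.Eventually.of_forall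
      fun s => ?_) ?_
    · refine ((A s).le_of_opNorm_le (hM s) _).trans ?_
      rw [norm_smul, Real.norm_eq_abs, Real.abs_exp]
      have := mul_le_mul_of_nonneg_left (hw s) (Real.exp_pos (2 * M * |s - x₀|)).le
      nlinarith
    · exact Continuous.intervalIntegrable (by fun_prop) _ _
  rw [intervalIntegral.integral_const_mul, abs_mul, abs_of_nonneg (by positivity)] at h1
  have h2 := norm_integral_exp_abs_le (K := 2 * M) (by positivity) x₀ x
  rw [norm_smul, Real.norm_eq_abs, Real.abs_exp, Real.exp_neg]
  have h3 : ‖∫ s in x₀..x, A s (Real.exp (2 * M * |s - x₀|) • w s)‖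
      ≤ M * R * (Real.exp (2 * M * |x - x₀|) / (2 * M)) :=
    h1.trans (mul_le_mul_of_nonneg_left h2 (by positivity))
  rw [inv_mul_le_iff₀ (Real.exp_pos _)]
  refine h3.trans (le_of_eq ?_)
  field_simp

/-- A linear differential equation with bounded measurable coefficients has a global solution, in
the integral sense, with an exponential bound. -/
theorem exists_linear_ode_solution [CompleteSpace F] {A : ℝ → F →L[ℝ] F}
    (hA : MeasureTheory.AEStronglyMeasurable A MeasureTheory.volume) {M : ℝ} (hM0 : 0 < M)
    (hM : ∀ s, ‖A s‖ ≤ M) (x₀ : ℝ) (y₀ : F) :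
    ∃ y : ℝ → F, Continuous y ∧ (∀ x, y x = y₀ + ∫ s in x₀..x, A s (y s)) ∧
      ∀ x, ‖y x‖ ≤ 2 * ‖y₀‖ * Real.exp (2 * M * |x - x₀|) := by
  -- Substituting `y = E • w` turns the Picard map into a contraction of the bounded continuous
  -- functions on the whole line, so no gluing of local solutions is needed.
  let E : ℝ → ℝ := fun x => Real.exp (2 * M * |x - x₀|)
  have hEc : Continuous E := by fun_prop
  have hint : ∀ w : BoundedContinuousFunction ℝ F, ∀ a b : ℝ,
      IntervalIntegrable (fun s => A s (E s • w s)) MeasureTheory.volume a b := fun w =>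
    intervalIntegrable_clm_apply hA hM (hEc.smul w.continuous)
  have hcont : ∀ w : BoundedContinuousFunction ℝ F, Continuous fun x =>
      Real.exp (-(2 * M * |x - x₀|)) • (y₀ + ∫ s in x₀..x, A s (E s • w s)) := fun w =>
    Continuous.smul (by fun_prop)
      (continuous_const.add (intervalIntegral.continuous_primitive (hint w) x₀))
  have hle : ∀ x, ‖Real.exp (-(2 * M * |x - x₀|)) • y₀‖ ≤ ‖y₀‖ := by
    intro x
    rw [norm_smul, Real.norm_eq_abs, Real.abs_exp]
    refine mul_le_of_le_one_left (norm_nonneg _) (Real.exp_le_one_iff.2 ?_)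
    have : 0 ≤ 2 * M * |x - x₀| := by positivity
    linarith
  have hbd : ∀ (w : BoundedContinuousFunction ℝ F) (x : ℝ),
      ‖Real.exp (-(2 * M * |x - x₀|)) • (y₀ + ∫ s in x₀..x, A s (E s • w s))‖
        ≤ ‖y₀‖ + ‖w‖ / 2 := by
    intro w x
    rw [smul_add]
    exact (norm_add_le _ _).trans (add_le_add (hle x)
      (norm_integral_exp_smul_le hM0 hM x₀ w.norm_coe_le_norm x))
  let Φ : BoundedContinuousFunction ℝ F → BoundedContinuousFunction ℝ F := fun w =>
    BoundedContinuousFunction.ofNormedAddCommGroup _ (hcont w) _ (hbd w)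
  have hΦ : ContractingWith (1 / 2) Φ := by
    refine ⟨by rw [← NNReal.coe_lt_coe]; norm_num, LipschitzWith.of_dist_le_mul fun v w => ?_⟩
    rw [BoundedContinuousFunction.dist_le (by positivity)]
    intro x
    have hsub : Φ v x - Φ w x = Real.exp (-(2 * M * |x - x₀|)) •
        ∫ s in x₀..x, A s (Real.exp (2 * M * |s - x₀|) • (v s - w s)) := by
      change Real.exp (-(2 * M * |x - x₀|)) • (y₀ + ∫ s in x₀..x, A s (E s • v s)) -
        Real.exp (-(2 * M * |x - x₀|)) • (y₀ + ∫ s in x₀..x, A s (E s • w s)) = _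
      rw [← smul_sub, add_sub_add_left_eq_sub, ← intervalIntegral.integral_sub (hint v _ _)
        (hint w _ _)]
      simp only [smul_sub, map_sub, E]
    rw [dist_eq_norm, hsub]
    refine (norm_integral_exp_smul_le hM0 hM x₀ (R := dist v w) (fun s => ?_) x).trans
      (le_of_eq ?_)
    · rw [← dist_eq_norm]; exact BoundedContinuousFunction.dist_coe_le_dist s
    · push_cast; ring
  let w := hΦ.fixedPoint
  have hw : Φ w = w := hΦ.fixedPoint_isFixedPt
  have hwx : ∀ x, w x = Real.exp (-(2 * M * |x - x₀|)) •
      (y₀ + ∫ s in x₀..x, A s (E s • w s)) := fun x => (DFunLike.congr_fun hw x).symm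
  refine ⟨fun x => E x • w x, hEc.smul w.continuous, fun x => ?_, fun x => ?_⟩
  · change E x • w x = _
    rw [hwx x, smul_smul, ← Real.exp_add]
    simp
  · have h1 : ‖w‖ ≤ ‖y₀‖ + ‖w‖ / 2 := by
      refine (BoundedContinuousFunction.norm_le (by positivity)).2 fun x => ?_
      rw [hwx x]
      exact hbd w x
    rw [norm_smul, Real.norm_eq_abs, Real.abs_exp, mul_comm]
    refine mul_le_mul_of_nonneg_right ?_ (Real.exp_pos _).le
    linarith [w.norm_coe_le_norm x]

end LinearODE

/-! ### Boundedness and symmetry of permittivities -/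

lemma PiecewiseSmooth.aestronglyMeasurable {f : ℝ → ℂ} (hf : PiecewiseSmooth f) :
    MeasureTheory.AEStronglyMeasurable f MeasureTheory.volume := by
  have hc := hf.countable
  have h1 : ContinuousOn f {x | ¬ ContinuousAt f x}ᶜ := fun x hx =>
    (not_not.1 hx : ContinuousAt f x).continuousWithinAt
  have h2 := h1.aestronglyMeasurable (μ := MeasureTheory.volume) hc.measurableSet.compl
  rwa [MeasureTheory.Measure.restrict_eq_self_of_ae_mem] at h2
  exact MeasureTheory.compl_mem_ae_iff.2 (hc.measure_zero _)

lemma PiecewiseSmooth.exists_bound_Icc {f : ℝ → ℂ} (hf : PiecewiseSmooth f) (a b : ℝ) :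
    ∃ M, ∀ x ∈ Icc a b, ‖f x‖ ≤ M := by
  refine (isCompact_Icc (a := a) (b := b)).induction_on (p := fun s => ∃ M, ∀ x ∈ s, ‖f x‖ ≤ M)
    ⟨0, by simp⟩ (fun s t hst ⟨M, hM⟩ => ⟨M, fun x hx => hM x (hst hx)⟩)
    (fun s t ⟨M, hM⟩ ⟨N, hN⟩ => ⟨max M N, fun x hx => ?_⟩) fun x _ => ?_
  · rcases hx with hx | hx
    · exact (hM x hx).trans (le_max_left _ _)
    · exact (hN x hx).trans (le_max_right _ _)
  · obtain ⟨g, h, hg, hh, h1, h2⟩ := hf x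
    have key : ∀ k : ℝ → ℂ, ContDiff ℝ (⊤ : ℕ∞) k → ∀ᶠ y in 𝓝 x, ‖k y‖ ≤ ‖k x‖ + 1 := fun k hk =>
      (hk.continuous.norm.tendsto x).eventually_le_const (lt_add_one _)
    -- The value at a breakpoint is unrelated to the one-sided pieces, hence the separate term `‖f
    -- x‖`.
    have e1 : ∀ᶠ y in 𝓝[<] x, ‖f y‖ ≤ max (‖f x‖) (max (‖g x‖ + 1) (‖h x‖ + 1)) := by
      filter_upwards [h1, nhdsWithin_le_nhds (key g hg)] with y hy hy'
      rw [hy]; exact hy'.trans ((le_max_left _ _).trans (le_max_right _ _))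
    have e2 : ∀ᶠ y in 𝓝[>] x, ‖f y‖ ≤ max (‖f x‖) (max (‖g x‖ + 1) (‖h x‖ + 1)) := by
      filter_upwards [h2, nhdsWithin_le_nhds (key h hh)] with y hy hy'
      rw [hy]; exact hy'.trans ((le_max_right _ _).trans (le_max_right _ _))
    have e3 : ∀ᶠ y in 𝓝[≠] x, ‖f y‖ ≤ max (‖f x‖) (max (‖g x‖ + 1) (‖h x‖ + 1)) := by
      rw [← Iio_union_Ioi, nhdsWithin_union]
      exact eventually_sup.2 ⟨e1, e2⟩
    have e4 : ∀ᶠ y in 𝓝 x, ‖f y‖ ≤ max (‖f x‖) (max (‖g x‖ + 1) (‖h x‖ + 1)) := by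
      filter_upwards [eventually_nhdsWithin_iff.1 e3] with y hy
      by_cases hyx : y = x
      · rw [hyx]; exact le_max_left _ _
      · exact hy hyx
    exact ⟨_, mem_nhdsWithin_of_mem_nhds e4, _, fun y hy => hy⟩

lemma IsPermittivity.exists_bound {x₀ : ℝ} {ε : ℝ → ℂ} (hε : IsPermittivity x₀ ε) :
    ∃ M, ∀ x, ‖ε x‖ ≤ M := by
  obtain ⟨M, hM⟩ := hε.piecewiseSmooth.exists_bound_Icc 0 1
  refine ⟨M, fun x => ?_⟩
  have hp : Function.Periodic ε 1 := hε.periodic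
  obtain ⟨y, hy, hxy⟩ := hp.exists_mem_Ico₀ one_pos x
  rw [hxy]
  exact hM y ⟨hy.1, hy.2.le⟩

lemma IsPermittivity.reflect {x₀ : ℝ} {ε : ℝ → ℂ} (hε : IsPermittivity x₀ ε) (x : ℝ) :
    ε (2 * x₀ - x) = ε x := by
  have hp : Function.Periodic ε 1 := hε.periodic
  have hz : ∀ (n : ℤ) y, ε (y + n) = ε y := fun n y => by simpa using hp.int_mul n y
  -- The symmetry hypothesis covers only the open cell; at the cell boundaries `x₀ + n` periodicity
  -- alone suffices.
  rcases (Int.fract_nonneg (x - x₀)).eq_or_lt with h | h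
  · have hx : x = x₀ + ⌊x - x₀⌋ := by
      have := Int.floor_add_fract (x - x₀); rw [← h] at this; linarith
    rw [hx, hz]
    have h2 := hz (-⌊x - x₀⌋) x₀
    push_cast at h2
    rw [← h2]; congr 1; rw [← hx]; linarith
  · have h1 := hε.inversion_symmetric (Int.fract (x - x₀)) ⟨h, Int.fract_lt_one _⟩
    have hx := Int.floor_add_fract (x - x₀)
    have h2 := hz ⌊x - x₀⌋ (x₀ + Int.fract (x - x₀))
    have h3 := hz (-⌊x - x₀⌋ - 1) (x₀ + 1 - Int.fract (x - x₀))
    push_cast at h3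
    rw [show x₀ + Int.fract (x - x₀) + ⌊x - x₀⌋ = x by linarith] at h2
    rw [show x₀ + 1 - Int.fract (x - x₀) + (-⌊x - x₀⌋ - 1) = 2 * x₀ - x by linarith] at h3
    rw [h2, h3, h1]

/-! ### Solutions, Wronskians and continuous dependence -/

section

variable {μ₀ : ℝ} {ε : ℝ → ℂ} {ω : ℂ}

lemma exists_solution (hε : PiecewiseSmooth ε) {M : ℝ} (hM0 : 0 < M) (hM : ∀ x, ‖ε x‖ ≤ M)
    (hω : ‖(μ₀ : ℂ) * ω ^ 2‖ ≤ M) (x₀ : ℝ) (a b : ℂ) :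
    ∃ u p, IsSolution μ₀ ε ω u p ∧ u x₀ = a ∧ p x₀ = b ∧
      (∀ x, ‖u x‖ ≤ 2 * max ‖a‖ ‖b‖ * Real.exp (2 * M * |x - x₀|)) ∧
      ∀ x, ‖p x‖ ≤ 2 * max ‖a‖ ‖b‖ * Real.exp (2 * M * |x - x₀|) := by
  let c : ℂ := -(μ₀ : ℂ) * ω ^ 2
  have hc : ‖c‖ ≤ M := by simpa [c] using hω
  -- The first order system is `(u, p)' = (ε p, c u)`. Splitting its matrix as `ε s • N₁ + N₂`
  -- reduces measurability to that of the scalar `ε`.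
  let N₁ : ℂ × ℂ →L[ℝ] ℂ × ℂ :=
    (ContinuousLinearMap.snd ℝ ℂ ℂ).prod (0 : ℂ × ℂ →L[ℝ] ℂ)
  let N₂ : ℂ × ℂ →L[ℝ] ℂ × ℂ :=
    (0 : ℂ × ℂ →L[ℝ] ℂ).prod (c • ContinuousLinearMap.fst ℝ ℂ ℂ)
  let A : ℝ → ℂ × ℂ →L[ℝ] ℂ × ℂ := fun s => ε s • N₁ + N₂
  have hAy : ∀ s y, A s y = (ε s * y.2, c * y.1) := by
    intro s y; simp [A, N₁, N₂]
  have hA : MeasureTheory.AEStronglyMeasurable A MeasureTheory.volume :=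
    (hε.aestronglyMeasurable.smul_const N₁).add MeasureTheory.aestronglyMeasurable_const
  have hAM : ∀ s, ‖A s‖ ≤ M := by
    refine fun s => ContinuousLinearMap.opNorm_le_bound _ hM0.le fun y => ?_
    rw [hAy, Prod.norm_mk, norm_mul, norm_mul]
    refine max_le (mul_le_mul (hM s) (norm_snd_le y) (norm_nonneg _) hM0.le)
      (mul_le_mul hc (norm_fst_le y) (norm_nonneg _) hM0.le)
  obtain ⟨y, hyc, hy, hyb⟩ := exists_linear_ode_solution hA hM0 hAM x₀ (a, b)
  have hint := intervalIntegrable_clm_apply hA hAM hyc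
  have hu : ∀ x, (y x).1 = a + ∫ s in x₀..x, ε s * (y s).2 := by
    intro x
    have h1 := (ContinuousLinearMap.fst ℝ ℂ ℂ).intervalIntegral_comp_comm (hint x₀ x)
    have h2 := congrArg Prod.fst (hy x)
    simp only [hAy, ContinuousLinearMap.coe_fst'] at h1
    rw [h2, h1]; simp only [hAy, Prod.fst_add]
  have hp : ∀ x, (y x).2 = b + ∫ s in x₀..x, c * (y s).1 := by
    intro x
    have h1 := (ContinuousLinearMap.snd ℝ ℂ ℂ).intervalIntegral_comp_comm (hint x₀ x)
    have h2 := congrArg Prod.snd (hy x)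
    simp only [hAy, ContinuousLinearMap.coe_snd'] at h1
    rw [h2, h1]; simp only [hAy, Prod.snd_add]
  have hm : MeasureTheory.AEStronglyMeasurable (fun s => ε s * (y s).2) MeasureTheory.volume :=
    hε.aestronglyMeasurable.mul hyc.snd.aestronglyMeasurable
  have hint1 : ∀ a b, IntervalIntegrable (fun s => ε s * (y s).2) MeasureTheory.volume a b :=
    fun a b => ((hyc.snd.norm.const_mul M).intervalIntegrable a b).mono_fun' hm.restrict
      (Filter.Eventually.of_forall fun s => by
        exact (norm_mul_le _ _).trans (mul_le_mul_of_nonneg_right (hM s) (norm_nonneg _)))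
  refine ⟨fun x => (y x).1, fun x => (y x).2, ⟨hyc.fst, hyc.snd, fun x hx => ?_, fun x => ?_⟩,
    by simp [hu x₀], by simp [hp x₀], fun x => ?_, fun x => ?_⟩
  · rw [funext hu]
    have := intervalIntegral.integral_hasDerivAt_right (hint1 x₀ x)
      ⟨univ, univ_mem, by simpa using hm⟩ (hx.mul hyc.snd.continuousAt)
    exact this.const_add a
  · rw [funext hp]
    have hcc : Continuous fun s => c * (y s).1 := by fun_prop
    have := (hcc.integral_hasStrictDerivAt x₀ x).hasDerivAt
    exact this.const_add b
  · exact (norm_fst_le _).trans (hyb x)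
  · exact (norm_snd_le _).trans (hyb x)

lemma IsSolution.linComb {u p v q : ℝ → ℂ} (hu : IsSolution μ₀ ε ω u p)
    (hv : IsSolution μ₀ ε ω v q) (a b : ℂ) :
    IsSolution μ₀ ε ω (fun x => a * u x + b * v x) (fun x => a * p x + b * q x) where
  continuous_u := (hu.continuous_u.const_mul a).add (hv.continuous_u.const_mul b)
  continuous_flux := (hu.continuous_flux.const_mul a).add (hv.continuous_flux.const_mul b)
  hasDerivAt_u x hx := (((hu.hasDerivAt_u x hx).const_mul a).add
    ((hv.hasDerivAt_u x hx).const_mul b)).congr_deriv (by ring)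
  hasDerivAt_flux x := (((hu.hasDerivAt_flux x).const_mul a).add
    ((hv.hasDerivAt_flux x).const_mul b)).congr_deriv (by ring)

lemma IsSolution.const_mul {u p : ℝ → ℂ} (hu : IsSolution μ₀ ε ω u p) (a : ℂ) :
    IsSolution μ₀ ε ω (fun x => a * u x) (fun x => a * p x) := by
  simpa using hu.linComb hu a 0

/-- Solutions for two permittivities and two frequencies: the change of the Wronskian. -/
lemma IsSolution.wronskian_sub {ε' : ℝ → ℂ} {ω' : ℂ} {u p v q : ℝ → ℂ}
    (hε : PiecewiseSmooth ε) (hε' : PiecewiseSmooth ε') {M : ℝ} (hM : ∀ x, ‖ε x - ε' x‖ ≤ M)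
    (hu : IsSolution μ₀ ε ω u p) (hv : IsSolution μ₀ ε' ω' v q) (a b : ℝ) :
    (u b * q b - v b * p b) - (u a * q a - v a * p a) =
      ∫ x in a..b, ((ε x - ε' x) * (p x * q x) + μ₀ * (ω ^ 2 - ω' ^ 2) * (u x * v x)) := by
  have hcont : Continuous fun x => u x * q x - v x * p x :=
    (hu.continuous_u.mul hv.continuous_flux).sub (hv.continuous_u.mul hu.continuous_flux)
  have hpq : Continuous fun x => p x * q x := hu.continuous_flux.mul hv.continuous_flux
  have huv : Continuous fun x => u x * v x := hu.continuous_u.mul hv.continuous_u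
  have h1 : IntervalIntegrable (fun x => (ε x - ε' x) * (p x * q x))
      MeasureTheory.volume a b := by
    refine ((hpq.norm.const_mul M).intervalIntegrable a b).mono_fun'
      ((hε.aestronglyMeasurable.sub hε'.aestronglyMeasurable).mul
        hpq.aestronglyMeasurable).restrict (Filter.Eventually.of_forall fun s => ?_)
    change ‖(ε s - ε' s) * (p s * q s)‖ ≤ _
    rw [norm_mul]
    exact mul_le_mul_of_nonneg_right (hM s) (norm_nonneg _)
  refine (MeasureTheory.integral_eq_of_hasDerivAt_off_countable
    (fun x => u x * q x - v x * p x) _ (a := a) (b := b)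
    (hε.countable.union hε'.countable) hcont.continuousOn ?_
    (h1.add ((huv.const_mul _).intervalIntegrable a b))).symm
  intro x hx
  have hx' : ContinuousAt ε x ∧ ContinuousAt ε' x := by simpa using hx.2
  have := ((hu.hasDerivAt_u x hx'.1).mul (hv.hasDerivAt_flux x)).sub
    ((hv.hasDerivAt_u x hx'.2).mul (hu.hasDerivAt_flux x))
  exact this.congr_deriv (by ring)

/-- A fundamental system of solutions, normalized at `x₀`. -/
structure IsFundamental (μ₀ : ℝ) (ε : ℝ → ℂ) (x₀ : ℝ) (ω : ℂ) (φ φf ψ ψf : ℝ → ℂ) : Prop where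
  left : IsSolution μ₀ ε ω φ φf
  right : IsSolution μ₀ ε ω ψ ψf
  left_u : φ x₀ = 1
  left_flux : φf x₀ = 0
  right_u : ψ x₀ = 0
  right_flux : ψf x₀ = 1

lemma exists_isFundamental {x₀ : ℝ} (hε : IsPermittivity x₀ ε) (μ₀ : ℝ) (ω : ℂ) :
    ∃ φ φf ψ ψf, IsFundamental μ₀ ε x₀ ω φ φf ψ ψf := by
  obtain ⟨M, hM⟩ := hε.exists_bound
  have hN0 : 0 < max M (max ‖(μ₀ : ℂ) * ω ^ 2‖ 1) := by positivity
  have hN1 : ∀ x, ‖ε x‖ ≤ max M (max ‖(μ₀ : ℂ) * ω ^ 2‖ 1) := fun x =>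
    (hM x).trans (le_max_left _ _)
  have hN2 : ‖(μ₀ : ℂ) * ω ^ 2‖ ≤ max M (max ‖(μ₀ : ℂ) * ω ^ 2‖ 1) :=
    (le_max_left _ _).trans (le_max_right _ _)
  obtain ⟨φ, φf, h1, h2, h3, -⟩ := exists_solution hε.piecewiseSmooth hN0 hN1 hN2 x₀ 1 0
  obtain ⟨ψ, ψf, h4, h5, h6, -⟩ := exists_solution hε.piecewiseSmooth hN0 hN1 hN2 x₀ 0 1
  exact ⟨φ, φf, ψ, ψf, h1, h4, h2, h3, h5, h6⟩

namespace IsFundamental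

variable {x₀ : ℝ} {φ φf ψ ψf : ℝ → ℂ}

lemma wronskian (h : IsFundamental μ₀ ε x₀ ω φ φf ψ ψf) (hε : PiecewiseSmooth ε) (x : ℝ) :
    φ x * ψf x - ψ x * φf x = 1 := by
  rw [IsSolution.wronskian_const hε h.left h.right x x₀, h.left_u, h.left_flux, h.right_u,
    h.right_flux]
  ring

/-- Cramer's rule: the Wronskians with `φ` and `ψ` are constant and read off the data at `x₀`. This
also gives uniqueness, despite the jumps of `ε`. -/
lemma eq_linComb (h : IsFundamental μ₀ ε x₀ ω φ φf ψ ψf) (hε : PiecewiseSmooth ε)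
    {u p : ℝ → ℂ} (hu : IsSolution μ₀ ε ω u p) (x : ℝ) :
    u x = u x₀ * φ x + p x₀ * ψ x ∧ p x = u x₀ * φf x + p x₀ * ψf x := by
  have h0 := h.wronskian hε x
  have h1 := IsSolution.wronskian_const hε hu h.left x x₀
  have h2 := IsSolution.wronskian_const hε hu h.right x x₀
  rw [h.left_u, h.left_flux] at h1
  rw [h.right_u, h.right_flux] at h2
  constructor
  · linear_combination (-u x) * h0 + φ x * h2 - ψ x * h1
  · linear_combination (-p x) * h0 + φf x * h2 - ψf x * h1

end IsFundamental

lemma IsSolution.unique {x₀ : ℝ} (hε : IsPermittivity x₀ ε) {u p v q : ℝ → ℂ}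
    (hu : IsSolution μ₀ ε ω u p) (hv : IsSolution μ₀ ε ω v q) (h1 : u x₀ = v x₀)
    (h2 : p x₀ = q x₀) : u = v ∧ p = q := by
  obtain ⟨φ, φf, ψ, ψf, h⟩ := exists_isFundamental hε μ₀ ω
  have ha := h.eq_linComb hε.piecewiseSmooth hu
  have hb := h.eq_linComb hε.piecewiseSmooth hv
  exact ⟨funext fun x => by rw [(ha x).1, (hb x).1, h1, h2],
    funext fun x => by rw [(ha x).2, (hb x).2, h1, h2]⟩

/-- By uniqueness every solution is the one built by fixed point, and inherits its exponential
bound. -/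
lemma IsSolution.norm_le {x₀ : ℝ} (hε : IsPermittivity x₀ ε) {M : ℝ} (hM0 : 0 < M)
    (hM : ∀ x, ‖ε x‖ ≤ M) (hω : ‖(μ₀ : ℂ) * ω ^ 2‖ ≤ M) {u p : ℝ → ℂ}
    (hu : IsSolution μ₀ ε ω u p) (h1 : ‖u x₀‖ ≤ 1) (h2 : ‖p x₀‖ ≤ 1) {x : ℝ}
    (hx : x ∈ Icc x₀ (x₀ + 1)) :
    ‖u x‖ ≤ 2 * Real.exp (2 * M) ∧ ‖p x‖ ≤ 2 * Real.exp (2 * M) := by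
  obtain ⟨v, q, hv, hv1, hv2, hb1, hb2⟩ :=
    exists_solution hε.piecewiseSmooth hM0 hM hω x₀ (u x₀) (p x₀)
  obtain ⟨rfl, rfl⟩ := hu.unique hε hv hv1.symm hv2.symm
  have key : 2 * max ‖u x₀‖ ‖p x₀‖ * Real.exp (2 * M * |x - x₀|) ≤ 2 * Real.exp (2 * M) := by
    have h3 : max ‖u x₀‖ ‖p x₀‖ ≤ 1 := max_le h1 h2
    have h4 : |x - x₀| ≤ 1 := abs_le.2 ⟨by linarith [hx.1], by linarith [hx.2]⟩
    have h5 : Real.exp (2 * M * |x - x₀|) ≤ Real.exp (2 * M) :=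
      Real.exp_le_exp.2 (mul_le_of_le_one_right (by positivity) h4)
    exact mul_le_mul (by linarith) h5 (Real.exp_pos _).le (by norm_num)
  exact ⟨(hb1 x).trans key, (hb2 x).trans key⟩

lemma IsSolution.norm_wronskian_sub_le {ε' : ℝ → ℂ} {ω' : ℂ} {u p v q : ℝ → ℂ}
    (hε : PiecewiseSmooth ε) (hε' : PiecewiseSmooth ε') {θ D x₀ : ℝ}
    (hθ : ∀ x, ‖ε x - ε' x‖ ≤ θ) (hω : ‖(μ₀ : ℂ) * (ω ^ 2 - ω' ^ 2)‖ ≤ θ)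
    (hu : IsSolution μ₀ ε ω u p) (hv : IsSolution μ₀ ε' ω' v q)
    (hu' : ∀ x ∈ Icc x₀ (x₀ + 1), ‖u x‖ ≤ D ∧ ‖p x‖ ≤ D)
    (hv' : ∀ x ∈ Icc x₀ (x₀ + 1), ‖v x‖ ≤ D ∧ ‖q x‖ ≤ D) {x : ℝ} (hx : x ∈ Icc x₀ (x₀ + 1)) :
    ‖(u x * q x - v x * p x) - (u x₀ * q x₀ - v x₀ * p x₀)‖ ≤ 2 * θ * D ^ 2 := by
  rw [IsSolution.wronskian_sub hε hε' hθ hu hv]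
  have hθ0 : 0 ≤ θ := (norm_nonneg _).trans (hθ x)
  have hD0 : 0 ≤ D := (norm_nonneg _).trans (hu' x hx).1
  refine (intervalIntegral.norm_integral_le_of_norm_le_const (C := 2 * θ * D ^ 2)
    fun s hs => ?_).trans ?_
  · rw [uIoc_of_le hx.1] at hs
    have hs' : s ∈ Icc x₀ (x₀ + 1) := ⟨hs.1.le, hs.2.trans hx.2⟩
    have h1 : ‖p s * q s‖ ≤ D * D := by
      rw [norm_mul]
      exact mul_le_mul (hu' s hs').2 (hv' s hs').2 (norm_nonneg _) hD0
    have h2 : ‖u s * v s‖ ≤ D * D := by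
      rw [norm_mul]
      exact mul_le_mul (hu' s hs').1 (hv' s hs').1 (norm_nonneg _) hD0
    refine (norm_add_le _ _).trans ?_
    rw [norm_mul, norm_mul (_ * _)]
    have h3 := mul_le_mul (hθ s) h1 (norm_nonneg _) hθ0
    have h4 := mul_le_mul hω h2 (norm_nonneg _) hθ0
    linarith
  · refine mul_le_of_le_one_right (by positivity) ?_
    exact abs_le.2 ⟨by linarith [hx.1], by linarith [hx.2]⟩

/-- Lipschitz dependence of the solutions on the permittivity and on the frequency. -/
lemma IsSolution.norm_sub_le {x₀ : ℝ} {ε' : ℝ → ℂ} {ω' : ℂ} {u p v q : ℝ → ℂ}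
    (hε : IsPermittivity x₀ ε) (hε' : IsPermittivity x₀ ε') {M θ : ℝ} (hM0 : 0 < M)
    (hM : ∀ x, ‖ε x‖ ≤ M) (hM' : ∀ x, ‖ε' x‖ ≤ M) (hω : ‖(μ₀ : ℂ) * ω ^ 2‖ ≤ M)
    (hω' : ‖(μ₀ : ℂ) * ω' ^ 2‖ ≤ M)
    (hθ : ∀ x, ‖ε x - ε' x‖ ≤ θ) (hθω : ‖(μ₀ : ℂ) * (ω ^ 2 - ω' ^ 2)‖ ≤ θ)
    (hu : IsSolution μ₀ ε ω u p) (hv : IsSolution μ₀ ε' ω' v q)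
    (h1 : u x₀ = v x₀) (h2 : p x₀ = q x₀) (h3 : ‖u x₀‖ ≤ 1) (h4 : ‖p x₀‖ ≤ 1)
    {x : ℝ} (hx : x ∈ Icc x₀ (x₀ + 1)) :
    ‖u x - v x‖ ≤ 4 * θ * (2 * Real.exp (2 * M)) ^ 3 ∧
      ‖p x - q x‖ ≤ 4 * θ * (2 * Real.exp (2 * M)) ^ 3 := by
  set D := 2 * Real.exp (2 * M) with hD
  obtain ⟨φ, φf, ψ, ψf, h⟩ := exists_isFundamental hε μ₀ ω
  have hφb : ∀ y ∈ Icc x₀ (x₀ + 1), ‖φ y‖ ≤ D ∧ ‖φf y‖ ≤ D := fun y hy =>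
    h.left.norm_le hε hM0 hM hω (by simp [h.left_u]) (by simp [h.left_flux]) hy
  have hψb : ∀ y ∈ Icc x₀ (x₀ + 1), ‖ψ y‖ ≤ D ∧ ‖ψf y‖ ≤ D := fun y hy =>
    h.right.norm_le hε hM0 hM hω (by simp [h.right_u]) (by simp [h.right_flux]) hy
  have hvb : ∀ y ∈ Icc x₀ (x₀ + 1), ‖v y‖ ≤ D ∧ ‖q y‖ ≤ D := fun y hy =>
    hv.norm_le hε' hM0 hM' hω' (h1 ▸ h3) (h2 ▸ h4) hy
  have hα := IsSolution.norm_wronskian_sub_le hε.piecewiseSmooth hε'.piecewiseSmooth hθ hθω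
    h.right hv hψb hvb hx
  have hβ := IsSolution.norm_wronskian_sub_le hε.piecewiseSmooth hε'.piecewiseSmooth hθ hθω
    h.left hv hφb hvb hx
  rw [h.right_u, h.right_flux] at hα
  rw [h.left_u, h.left_flux] at hβ
  obtain ⟨e1, e2⟩ := h.eq_linComb hε.piecewiseSmooth hu x
  have hw := h.wronskian hε.piecewiseSmooth x
  have hθ0 : 0 ≤ θ := (norm_nonneg _).trans (hθ x)
  -- Variation of constants: in the basis `φ`, `ψ` the error has as coefficients the changes of the
  -- Wronskians with `v`, each at most `2θD²`.
  have e3 : u x - v x = ((ψ x * q x - v x * ψf x) - (0 * q x₀ - v x₀ * 1)) * φ x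
      - ((φ x * q x - v x * φf x) - (1 * q x₀ - v x₀ * 0)) * ψ x := by
    rw [e1, h1, h2]; linear_combination (v x) * hw
  have e4 : p x - q x = ((ψ x * q x - v x * ψf x) - (0 * q x₀ - v x₀ * 1)) * φf x
      - ((φ x * q x - v x * φf x) - (1 * q x₀ - v x₀ * 0)) * ψf x := by
    rw [e2, h1, h2]; linear_combination (q x) * hw
  have bound : ∀ {α β y z : ℂ}, ‖α‖ ≤ 2 * θ * D ^ 2 → ‖β‖ ≤ 2 * θ * D ^ 2 → ‖y‖ ≤ D → ‖z‖ ≤ D →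
      ‖α * y - β * z‖ ≤ 4 * θ * D ^ 3 := by
    intro α β y z ha hb hy hz
    refine (_root_.norm_sub_le _ _).trans ?_
    rw [norm_mul, norm_mul]
    have h5 := mul_le_mul ha hy (norm_nonneg _) (by positivity)
    have h6 := mul_le_mul hb hz (norm_nonneg _) (by positivity)
    nlinarith
  exact ⟨e3 ▸ bound hα hβ (hφb x hx).1 (hψb x hx).1, e4 ▸ bound hα hβ (hφb x hx).2 (hψb x hx).2⟩

end

/-! ### Floquet multipliers and geometric decay -/

lemma exists_quadratic_root_norm_le_one (a : ℂ) :
    ∃ z : ℂ, z ^ 2 - 2 * a * z + 1 = 0 ∧ ‖z‖ ≤ 1 := by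
  obtain ⟨s, hs⟩ := IsAlgClosed.exists_pow_nat_eq (a ^ 2 - 1) two_pos
  -- The roots `a ± s` have product one, so one of them lies in the closed disc.
  rcases le_total ‖a + s‖ 1 with h | h
  · exact ⟨a + s, by linear_combination hs, h⟩
  · refine ⟨a - s, by linear_combination hs, ?_⟩
    have h1 : ‖a + s‖ * ‖a - s‖ = 1 := by
      rw [← norm_mul, show (a + s) * (a - s) = 1 by linear_combination -hs, norm_one]
    nlinarith [norm_nonneg (a - s)]

/-- Stability of the root of `z² - 2 a z + 1` inside the unit disc. -/
lemma quadratic_root_dist_le {a a' z z' : ℂ} (h : z ^ 2 - 2 * a * z + 1 = 0)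
    (h' : z' ^ 2 - 2 * a' * z' + 1 = 0) (hz : ‖z‖ ≤ 1) (hz' : ‖z'‖ < 1) :
    ‖z - z'‖ ≤ 2 * ‖a - a'‖ / (1 - ‖z'‖) := by
  -- This is the difference of the equations `z + 1/z = 2a` and `z' + 1/z' = 2a'`, with denominators
  -- cleared.
  have e : (z - z') * (1 - z * z') = 2 * (a' - a) * (z * z') := by
    linear_combination z * h' - z' * h
  have h1 : 1 - ‖z'‖ ≤ ‖1 - z * z'‖ := by
    have h2 := norm_sub_norm_le (1 : ℂ) (z * z')
    rw [norm_one, norm_mul] at h2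
    nlinarith [norm_nonneg z']
  have h3 : ‖z - z'‖ * ‖1 - z * z'‖ ≤ 2 * ‖a - a'‖ := by
    rw [← norm_mul, e, norm_mul, norm_mul, norm_mul, norm_sub_rev a' a, RCLike.norm_ofNat]
    refine mul_le_of_le_one_right (by positivity) ?_
    nlinarith [norm_nonneg z, norm_nonneg z']
  rw [le_div_iff₀ (by linarith)]
  exact (mul_le_mul_of_nonneg_left h1 (norm_nonneg _)).trans h3

lemma tendsto_zero_of_quasiperiodic {f : ℝ → ℂ} (hf : Continuous f) {lam : ℂ} (hlam : ‖lam‖ < 1)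
    (h : ∀ x, f (x + 1) = lam * f x) : Tendsto f atTop (𝓝 0) := by
  obtain ⟨C, hC⟩ := (isCompact_Icc (a := (0 : ℝ)) (b := 1)).exists_bound_of_continuousOn
    hf.continuousOn
  have hn : ∀ (n : ℕ) x, f (x + n) = lam ^ n * f x := by
    intro n
    induction n with
    | zero => simp
    | succ n ih =>
      intro x
      rw [Nat.cast_succ, ← add_assoc, h, ih, pow_succ]; ring
  have hle : ∀ᶠ x : ℝ in atTop, ‖f x‖ ≤ ‖lam‖ ^ ⌊x⌋₊ * C := by
    filter_upwards [eventually_ge_atTop 0] with x hx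
    have h1 := hn ⌊x⌋₊ (x - ⌊x⌋₊)
    rw [sub_add_cancel] at h1
    rw [h1, norm_mul, norm_pow]
    refine mul_le_mul_of_nonneg_left (hC _ ⟨?_, ?_⟩) (by positivity)
    · linarith [Nat.floor_le hx]
    · linarith [Nat.lt_floor_add_one x]
  refine squeeze_zero_norm' hle ?_
  simpa using ((tendsto_pow_atTop_nhds_zero_of_lt_one (norm_nonneg lam) hlam).comp
    tendsto_nat_floor_atTop).mul_const C

/-! ### Monodromy matrix and decaying Floquet modes -/

section

variable {μ₀ : ℝ} {ε : ℝ → ℂ} {x₀ : ℝ} {ω : ℂ}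

lemma IsSolution.reflect (hε : IsPermittivity x₀ ε) {u p : ℝ → ℂ}
    (hu : IsSolution μ₀ ε ω u p) :
    IsSolution μ₀ ε ω (fun x => u (2 * x₀ - x)) (fun x => -p (2 * x₀ - x)) where
  continuous_u := hu.continuous_u.comp (by fun_prop)
  continuous_flux := (hu.continuous_flux.comp (by fun_prop)).neg
  hasDerivAt_u x hx := by
    have hc : ContinuousAt ε (2 * x₀ - x) := by
      have h1 : ε = fun y => ε (2 * x₀ - y) := funext fun y => (hε.reflect y).symm
      rw [h1]
      refine ContinuousAt.comp (f := fun y => 2 * x₀ - y) ?_ (by fun_prop)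
      simpa using hx
    have h2 := (hu.hasDerivAt_u _ hc).comp_const_sub (2 * x₀) x
    rw [hε.reflect] at h2
    exact h2.congr_deriv (by ring)
  hasDerivAt_flux x :=
    ((hu.hasDerivAt_flux (2 * x₀ - x)).comp_const_sub (2 * x₀) x).neg.congr_deriv (by ring)

lemma IsSolution.translate (hε : IsPermittivity x₀ ε) {u p : ℝ → ℂ}
    (hu : IsSolution μ₀ ε ω u p) :
    IsSolution μ₀ ε ω (fun x => u (x + 1)) (fun x => p (x + 1)) where
  continuous_u := hu.continuous_u.comp (by fun_prop)
  continuous_flux := hu.continuous_flux.comp (by fun_prop)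
  hasDerivAt_u x hx := by
    have hc : ContinuousAt ε (x + 1) := by
      have h1 : ε = fun y => ε (y - 1) := funext fun y => by
        rw [← hε.periodic (y - 1), sub_add_cancel]
      rw [h1]
      refine ContinuousAt.comp (f := fun y => y - 1) ?_ (by fun_prop)
      simpa using hx
    have h2 := (hu.hasDerivAt_u _ hc).comp_add_const x 1
    rwa [hε.periodic] at h2
  hasDerivAt_flux x := (hu.hasDerivAt_flux (x + 1)).comp_add_const x 1

/-- At the dense set of continuity points `ε p = u' = 0`, while `Re ε > 0` excludes `ε = 0`. -/
lemma IsSolution.flux_eq_zero (hε : IsPermittivity x₀ ε) {u p : ℝ → ℂ}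
    (hu : IsSolution μ₀ ε ω u p) (h0 : u = 0) : p = 0 := by
  refine Continuous.ext_on (hε.piecewiseSmooth.countable.dense_compl ℝ) hu.continuous_flux
    continuous_const fun x hx => ?_
  have h1 := hu.hasDerivAt_u x (not_not.1 hx)
  rw [h0] at h1
  have h2 := h1.unique (hasDerivAt_const x (0 : ℂ))
  refine (mul_eq_zero.1 h2).resolve_left fun h3 => ?_
  simpa [h3] using hε.re_pos x

namespace IsFundamental

variable {φ φf ψ ψf : ℝ → ℂ}

/-- The monodromy matrix of an inversion symmetric material has equal diagonal entries. -/
lemma monodromy_diag_eq (h : IsFundamental μ₀ ε x₀ ω φ φf ψ ψf) (hε : IsPermittivity x₀ ε) :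
    ψf (x₀ + 1) = φ (x₀ + 1) := by
  have hps := hε.piecewiseSmooth
  have e : 2 * x₀ - (x₀ - 1) = x₀ + 1 := by ring
  obtain ⟨r1, r2⟩ := h.eq_linComb hps (h.left.reflect hε) (x₀ - 1)
  obtain ⟨r3, r4⟩ := h.eq_linComb hps (h.right.reflect hε) (x₀ - 1)
  obtain ⟨t1, t2⟩ := h.eq_linComb hps (h.left.translate hε) (x₀ - 1)
  obtain ⟨t3, t4⟩ := h.eq_linComb hps (h.right.translate hε) (x₀ - 1)
  have hw := h.wronskian hps (x₀ + 1)
  simp only [e, sub_add_cancel, show 2 * x₀ - x₀ = x₀ by ring, h.left_u, h.left_flux, h.right_u,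
    h.right_flux, neg_zero] at r1 r2 r3 r4 t1 t2 t3 t4
  have r1' : φ (x₀ - 1) = φ (x₀ + 1) := by linear_combination -r1
  have r2' : φf (x₀ - 1) = -φf (x₀ + 1) := by linear_combination -r2
  have r3' : ψ (x₀ - 1) = -ψ (x₀ + 1) := by linear_combination r3
  have r4' : ψf (x₀ - 1) = ψf (x₀ + 1) := by linear_combination r4
  rw [r1', r3'] at t1 t3
  rw [r2', r4'] at t2 t4
  -- With diagonal entries `a`, `d` and off-diagonal product `b`, reflection and translation give
  -- `a² - b = d² - b = 1`, while the determinant gives `ad - b = 1`.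
  have h0 : (ψf (x₀ + 1) - φ (x₀ + 1)) ^ 2 = 0 := by
    linear_combination (-1 : ℂ) * t4 - t1 - 2 * hw
  exact sub_eq_zero.1 (pow_eq_zero_iff two_ne_zero |>.1 h0)

lemma monodromy_det (h : IsFundamental μ₀ ε x₀ ω φ φf ψ ψf) (hε : IsPermittivity x₀ ε) :
    φ (x₀ + 1) ^ 2 - ψ (x₀ + 1) * φf (x₀ + 1) = 1 := by
  have hw := h.wronskian hε.piecewiseSmooth (x₀ + 1)
  rw [h.monodromy_diag_eq hε] at hw
  linear_combination hw

lemma quasiperiodic_linComb (h : IsFundamental μ₀ ε x₀ ω φ φf ψ ψf) (hε : IsPermittivity x₀ ε)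
    {A B lam : ℂ} (h1 : φ (x₀ + 1) * A + ψ (x₀ + 1) * B = lam * A)
    (h2 : φf (x₀ + 1) * A + φ (x₀ + 1) * B = lam * B) (x : ℝ) :
    A * φ (x + 1) + B * ψ (x + 1) = lam * (A * φ x + B * ψ x) ∧
      A * φf (x + 1) + B * ψf (x + 1) = lam * (A * φf x + B * ψf x) := by
  obtain ⟨e1, e2⟩ := h.eq_linComb hε.piecewiseSmooth ((h.left.linComb h.right A B).translate hε) x
  rw [h.monodromy_diag_eq hε, mul_comm A (φ (x₀ + 1)), mul_comm B (ψ (x₀ + 1)), h1,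
    mul_comm A (φf (x₀ + 1)), mul_comm B (φ (x₀ + 1)), h2] at e1 e2
  exact ⟨by rw [e1]; ring, by rw [e2]; ring⟩

end IsFundamental

/-- A Floquet solution decaying at `+∞`, with multiplier `lam`, normalized to have unit flux at
`x₀`. -/
structure IsDecayingMode (μ₀ : ℝ) (ε : ℝ → ℂ) (x₀ : ℝ) (ω lam r : ℂ) (u p : ℝ → ℂ) : Prop where
  isSolution : IsSolution μ₀ ε ω u p
  u_eq : u x₀ = r
  flux_eq : p x₀ = 1
  u_add_one : ∀ x, u (x + 1) = lam * u x
  flux_add_one : ∀ x, p (x + 1) = lam * p x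
  norm_lt_one : ‖lam‖ < 1

lemma quadratic_root_ne {a lam : ℂ} (hlam : lam ^ 2 - 2 * a * lam + 1 = 0)
    (hlt : ‖lam‖ < 1) : lam - a ≠ 0 := by
  intro h0
  have h1 : lam ^ 2 = 1 := by rw [← sub_eq_zero.1 h0] at hlam; linear_combination -hlam
  have h2 : ‖lam‖ ^ 2 = 1 := by rw [← norm_pow, h1, norm_one]
  nlinarith [norm_nonneg lam]

/-- The eigenvector of the monodromy matrix can be scaled to unit flux because `lam - a` is nonzero;
its second row holds since `(lam - a)² = a² - 1` is the off-diagonal product. -/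
lemma IsFundamental.isDecayingMode {φ φf ψ ψf : ℝ → ℂ}
    (h : IsFundamental μ₀ ε x₀ ω φ φf ψ ψf) (hε : IsPermittivity x₀ ε) {lam : ℂ}
    (hlam : lam ^ 2 - 2 * φ (x₀ + 1) * lam + 1 = 0) (hlt : ‖lam‖ < 1) :
    IsDecayingMode μ₀ ε x₀ ω lam (ψ (x₀ + 1) / (lam - φ (x₀ + 1)))
      (fun x => ψ (x₀ + 1) / (lam - φ (x₀ + 1)) * φ x + 1 * ψ x)
      (fun x => ψ (x₀ + 1) / (lam - φ (x₀ + 1)) * φf x + 1 * ψf x) := by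
  have h0 := quadratic_root_ne hlam hlt
  have hd := h.monodromy_det hε
  have h1 : φ (x₀ + 1) * (ψ (x₀ + 1) / (lam - φ (x₀ + 1))) + ψ (x₀ + 1) * 1 =
      lam * (ψ (x₀ + 1) / (lam - φ (x₀ + 1))) := by field_simp; ring
  have h2 : φf (x₀ + 1) * (ψ (x₀ + 1) / (lam - φ (x₀ + 1))) + φ (x₀ + 1) * 1 = lam * 1 := by
    field_simp
    linear_combination -hd - hlam
  exact ⟨h.left.linComb h.right _ _, by simp [h.left_u, h.right_u],
    by simp [h.left_flux, h.right_flux], fun x => (h.quasiperiodic_linComb hε h1 h2 x).1,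
    fun x => (h.quasiperiodic_linComb hε h1 h2 x).2, hlt⟩

namespace IsDecayingMode

variable {lam r : ℂ} {u p : ℝ → ℂ}

lemma multiplier_root (hm : IsDecayingMode μ₀ ε x₀ ω lam r u p) (hε : IsPermittivity x₀ ε)
    {φ φf ψ ψf : ℝ → ℂ} (h : IsFundamental μ₀ ε x₀ ω φ φf ψ ψf) :
    lam ^ 2 - 2 * φ (x₀ + 1) * lam + 1 = 0 ∧ r = ψ (x₀ + 1) / (lam - φ (x₀ + 1)) := by
  obtain ⟨e1, e2⟩ := h.eq_linComb hε.piecewiseSmooth hm.isSolution (x₀ + 1)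
  rw [hm.u_add_one, hm.u_eq, hm.flux_eq] at e1
  rw [hm.flux_add_one, hm.u_eq, hm.flux_eq, h.monodromy_diag_eq hε] at e2
  have hd := h.monodromy_det hε
  have h1 : lam ^ 2 - 2 * φ (x₀ + 1) * lam + 1 = 0 := by
    linear_combination (lam - φ (x₀ + 1)) * e2 + φf (x₀ + 1) * e1 - hd
  refine ⟨h1, ?_⟩
  rw [eq_div_iff (quadratic_root_ne h1 hm.norm_lt_one)]
  linear_combination e1

lemma multiplier_ne_one (hm : IsDecayingMode μ₀ ε x₀ ω lam r u p) : lam ≠ 1 := by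
  rintro rfl
  simpa using hm.norm_lt_one

/-- The Wronskian of the mode with a Bloch wave is constant, yet is multiplied over a cell by a
number of modulus below one. It vanishes, so the two are proportional, which is impossible as their
multipliers have different moduli. -/
lemma not_mem_blochSpectrum (hm : IsDecayingMode μ₀ ε x₀ ω lam r u p)
    (hε : IsPermittivity x₀ ε) : ω ∉ blochSpectrum μ₀ ε := by
  rintro ⟨κ, -, v, q, hv, hv0, hv1, hq1⟩
  have hτ : ‖Complex.exp (Complex.I * κ)‖ = 1 := by
    rw [mul_comm]; exact Complex.norm_exp_ofReal_mul_I κ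
  set τ := Complex.exp (Complex.I * κ)
  have hw := IsSolution.wronskian_const hε.piecewiseSmooth hm.isSolution hv (x₀ + 1) x₀
  rw [hm.u_add_one, hm.flux_add_one, hv1, hq1] at hw
  have hne : lam * τ - 1 ≠ 0 := by
    intro h0
    have h1 : ‖lam * τ‖ = 1 := by rw [sub_eq_zero.1 h0, norm_one]
    rw [norm_mul, hτ, mul_one] at h1
    exact hm.norm_lt_one.ne h1
  have hw0 : u x₀ * q x₀ - v x₀ * p x₀ = 0 := by
    refine (mul_eq_zero.1 (?_ : (lam * τ - 1) * _ = 0)).resolve_left hne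
    linear_combination hw
  rw [hm.flux_eq] at hw0
  obtain ⟨hvu, -⟩ := hv.unique hε (hm.isSolution.const_mul (q x₀))
    (by linear_combination -hw0) (by rw [hm.flux_eq, mul_one])
  obtain ⟨x, hx⟩ := Function.ne_iff.1 hv0
  have h2 := hv1 x
  have h3 : (τ - lam) * v x = 0 := by
    rw [hvu] at h2 ⊢
    simp only [hm.u_add_one] at h2
    linear_combination -h2
  have h4 := sub_eq_zero.1 ((mul_eq_zero.1 h3).resolve_right hx)
  exact hm.norm_lt_one.ne (h4 ▸ hτ)

lemma exists_ne_zero (hm : IsDecayingMode μ₀ ε x₀ ω lam r u p) :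
    ∃ x ∈ Icc x₀ (x₀ + 1), u x ≠ 0 := by
  by_contra! h0
  have h1 := intervalIntegral.integral_eq_sub_of_hasDerivAt (a := x₀) (b := x₀ + 1)
    (fun x _ => hm.isSolution.hasDerivAt_flux x)
    ((hm.isSolution.continuous_u.const_mul _).intervalIntegrable _ _)
  rw [intervalIntegral.integral_congr (g := fun _ => (0 : ℂ)), hm.flux_add_one, hm.flux_eq] at h1
  · simp only [intervalIntegral.integral_zero, mul_one] at h1
    exact hm.multiplier_ne_one (sub_eq_zero.1 h1.symm)
  · intro s hs
    rw [uIcc_of_le (by linarith)] at hs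
    simp [h0 s hs]

lemma ne_zero (hm : IsDecayingMode μ₀ ε x₀ ω lam r u p) : u ≠ 0 := by
  obtain ⟨x, -, hx⟩ := hm.exists_ne_zero
  exact fun h => hx (congrFun h x)

/-- At zero frequency the flux is constant, which would force the multiplier one. -/
lemma omega_ne_zero (hm : IsDecayingMode μ₀ ε x₀ ω lam r u p) : ω ≠ 0 := by
  rintro rfl
  have hp : ∀ x, HasDerivAt p 0 x := fun x => by
    simpa using hm.isSolution.hasDerivAt_flux x
  have h1 := is_const_of_deriv_eq_zero (fun x => (hp x).differentiableAt)
    (fun x => (hp x).deriv) (x₀ + 1) x₀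
  rw [hm.flux_add_one, hm.flux_eq, mul_one] at h1
  exact hm.multiplier_ne_one h1

lemma isRatio (hm : IsDecayingMode μ₀ ε x₀ ω lam r u p) : IsRatio μ₀ ε x₀ atTop ω r :=
  ⟨u, p, ⟨hm.isSolution, hm.ne_zero,
    tendsto_zero_of_quasiperiodic hm.isSolution.continuous_u hm.norm_lt_one hm.u_add_one,
    tendsto_zero_of_quasiperiodic hm.isSolution.continuous_flux hm.norm_lt_one hm.flux_add_one⟩,
    by simp [hm.flux_eq], by simp [hm.flux_eq, hm.u_eq]⟩

lemma isRatio_atBot (hm : IsDecayingMode μ₀ ε x₀ ω lam r u p) (hε : IsPermittivity x₀ ε) :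
    IsRatio μ₀ ε x₀ atBot ω (-r) := by
  have ht : Tendsto (fun x => 2 * x₀ - x) atBot atTop :=
    tendsto_atTop_add_const_left _ _ tendsto_neg_atBot_atTop
  refine ⟨_, _, ⟨hm.isSolution.reflect hε, fun h0 => hm.ne_zero (funext fun x => ?_),
    (tendsto_zero_of_quasiperiodic hm.isSolution.continuous_u hm.norm_lt_one hm.u_add_one).comp ht,
    ?_⟩, ?_, ?_⟩
  · simpa using congrFun h0 (2 * x₀ - x)
  · simpa using ((tendsto_zero_of_quasiperiodic hm.isSolution.continuous_flux hm.norm_lt_one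
      hm.flux_add_one).comp ht).neg
  · simp [show 2 * x₀ - x₀ = x₀ by ring, hm.flux_eq]
  · simp [show 2 * x₀ - x₀ = x₀ by ring, hm.flux_eq, hm.u_eq, div_neg]

end IsDecayingMode

lemma ratio_eq_of_isRatio (hε : PiecewiseSmooth ε) {l : Filter ℝ} [l.NeBot] {z : ℂ}
    (hz : IsRatio μ₀ ε x₀ l ω z) : ratio μ₀ ε x₀ l ω = (z : OnePoint ℂ) := by
  have h : ∃ z, IsRatio μ₀ ε x₀ l ω z := ⟨z, hz⟩
  rw [ratio, dif_pos h, isRatio_unique hε h.choose_spec hz]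

lemma interfaceImpedance_eq {εA εB : ℝ → ℂ} (hA : IsPermittivity x₀ εA)
    (hB : IsPermittivity x₀ εB) {lamA rA lamB rB : ℂ} {uA pA uB pB : ℝ → ℂ}
    (hmA : IsDecayingMode μ₀ εA x₀ ω lamA rA uA pA)
    (hmB : IsDecayingMode μ₀ εB x₀ ω lamB rB uB pB) :
    interfaceImpedance μ₀ εA εB x₀ ω = ((rA + rB : ℂ) : OnePoint ℂ) := by
  have h1 : surfaceImpedanceA μ₀ εA x₀ ω = (rA : OnePoint ℂ) := by
    rw [surfaceImpedanceA, ratio_eq_of_isRatio hA.piecewiseSmooth (hmA.isRatio_atBot hA),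
      OnePoint.map_some, neg_neg]
  have h2 : surfaceImpedanceB μ₀ εB x₀ ω = (rB : OnePoint ℂ) :=
    ratio_eq_of_isRatio hB.piecewiseSmooth hmB.isRatio
  rw [interfaceImpedance, h1, h2]
  rfl

/-- A multiplier of modulus one would be `exp(iκ)` with `κ` its argument, and its eigenvector would
start a Bloch wave. -/
lemma exists_isDecayingMode (hε : IsPermittivity x₀ ε) (hω : ω ∉ blochSpectrum μ₀ ε) :
    ∃ lam r u p, IsDecayingMode μ₀ ε x₀ ω lam r u p := by
  obtain ⟨φ, φf, ψ, ψf, h⟩ := exists_isFundamental hε μ₀ ω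
  obtain ⟨lam, hlam, hle⟩ := exists_quadratic_root_norm_le_one (φ (x₀ + 1))
  rcases hle.lt_or_eq with hlt | heq
  · exact ⟨lam, _, _, _, h.isDecayingMode hε hlam hlt⟩
  refine absurd ?_ hω
  have hd := h.monodromy_det hε
  obtain ⟨A, B, hAB, h1, h2⟩ : ∃ A B : ℂ, (A ≠ 0 ∨ B ≠ 0) ∧
      φ (x₀ + 1) * A + ψ (x₀ + 1) * B = lam * A ∧
      φf (x₀ + 1) * A + φ (x₀ + 1) * B = lam * B := by
    -- `(ψ(x₀ + 1), lam - φ(x₀ + 1))` is an eigenvector unless it vanishes, in which case `(0, 1)`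
    -- is one.
    by_cases h0 : ψ (x₀ + 1) ≠ 0 ∨ lam - φ (x₀ + 1) ≠ 0
    · exact ⟨_, _, h0, by ring, by linear_combination -hd - hlam⟩
    · push Not at h0
      refine ⟨0, 1, Or.inr one_ne_zero, by simp [h0.1], ?_⟩
      linear_combination -h0.2
  have hexp : Complex.exp (Complex.I * lam.arg) = lam := by
    have := Complex.norm_mul_exp_arg_mul_I lam
    rwa [heq, Complex.ofReal_one, one_mul, mul_comm] at this
  have hq := h.quasiperiodic_linComb hε h1 h2
  refine ⟨lam.arg, ⟨(Complex.neg_pi_lt_arg _).le, Complex.arg_le_pi _⟩, _, _,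
    h.left.linComb h.right A B, fun h0 => ?_, fun x => by rw [hexp]; exact (hq x).1,
    fun x => by rw [hexp]; exact (hq x).2⟩
  have hA : A = 0 := by simpa [h.left_u, h.right_u] using congrFun h0 x₀
  have hB : B = 0 := by
    simpa [h.left_flux, h.right_flux] using
      congrFun ((h.left.linComb h.right A B).flux_eq_zero hε h0) x₀
  exact hAB.elim (fun h => h hA) (fun h => h hB)

end

/-! ### Perturbation of modes and increments of the impedance -/

section

variable {μ₀ : ℝ} {ε : ℝ → ℂ} {x₀ : ℝ} {ω lam r : ℂ} {u p : ℝ → ℂ}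

/-- Continuous dependence of the decaying modes on the permittivity and on the frequency. -/
theorem IsDecayingMode.exists_perturbation (hm : IsDecayingMode μ₀ ε x₀ ω lam r u p)
    (hε : IsPermittivity x₀ ε) {ι : Type*} {l : Filter ι} {ε' : ι → ℝ → ℂ} {ω' : ι → ℂ}
    {θ : ι → ℝ} (hε' : ∀ᶠ i in l, IsPermittivity x₀ (ε' i))
    (hθ : ∀ᶠ i in l, ∀ x, ‖ε x - ε' i x‖ ≤ θ i) (hθ0 : Tendsto θ l (𝓝 0))
    (hω' : Tendsto ω' l (𝓝 ω)) :
    ∃ (lam' r' : ι → ℂ) (u' p' : ι → ℝ → ℂ) (C : ℝ),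
      (∀ᶠ i in l, IsDecayingMode μ₀ (ε' i) x₀ (ω' i) (lam' i) (r' i) (u' i) (p' i)) ∧
      Tendsto lam' l (𝓝 lam) ∧ Tendsto r' l (𝓝 r) ∧
      (∀ x ∈ Icc x₀ (x₀ + 1), Tendsto (fun i => u' i x) l (𝓝 (u x))) ∧
      ∀ᶠ i in l, ∀ x ∈ Icc x₀ (x₀ + 1), ‖u' i x‖ ≤ C := by
  obtain ⟨φ, φf, ψ, ψf, h⟩ := exists_isFundamental hε μ₀ ω
  have hfund : ∀ i, ∃ φ' φf' ψ' ψf', IsPermittivity x₀ (ε' i) →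
      IsFundamental μ₀ (ε' i) x₀ (ω' i) φ' φf' ψ' ψf' := by
    intro i
    by_cases hi : IsPermittivity x₀ (ε' i)
    · obtain ⟨φ', φf', ψ', ψf', h'⟩ := exists_isFundamental hi μ₀ (ω' i)
      exact ⟨φ', φf', ψ', ψf', fun _ => h'⟩
    -- Default values, for indices at which `ε' i` is not a permittivity.
    · exact ⟨0, 0, 0, 0, fun h' => absurd h' hi⟩
  choose φ' φf' ψ' ψf' h' using hfund
  choose Λ hΛ hΛle using exists_quadratic_root_norm_le_one
  obtain ⟨M₀, hM₀⟩ := hε.exists_bound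
  set M : ℝ := max (M₀ + 1) (‖(μ₀ : ℂ) * ω ^ 2‖ + 1) with hMdef
  have hM0 : 0 < M := lt_max_of_lt_right (by positivity)
  have hM : ∀ x, ‖ε x‖ ≤ M := fun x => (hM₀ x).trans (by rw [hMdef]; simp)
  have hMω : ‖(μ₀ : ℂ) * ω ^ 2‖ ≤ M := le_max_of_le_right (by linarith)
  have hMω' : ∀ᶠ i in l, ‖(μ₀ : ℂ) * ω' i ^ 2‖ ≤ M :=
    ((hω'.pow 2).const_mul (μ₀ : ℂ)).norm.eventually_le_const
      (lt_max_of_lt_right (lt_add_one _))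
  have hM' : ∀ᶠ i in l, ∀ x, ‖ε' i x‖ ≤ M := by
    filter_upwards [hθ, hθ0.eventually_le_const one_pos] with i hi hi1 x
    have h1 : ‖ε' i x‖ ≤ ‖ε x‖ + ‖ε x - ε' i x‖ := by
      simpa using norm_sub_le (ε x) (ε x - ε' i x)
    exact (h1.trans (add_le_add (hM₀ x) ((hi x).trans hi1))).trans (le_max_left _ _)
  set η : ι → ℝ := fun i => max (θ i) ‖(μ₀ : ℂ) * (ω ^ 2 - ω' i ^ 2)‖ with hη
  have hη0 : Tendsto η l (𝓝 0) := by
    have h1 : Tendsto (fun i => ‖(μ₀ : ℂ) * (ω ^ 2 - ω' i ^ 2)‖) l (𝓝 0) := by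
      have h2 := (((tendsto_const_nhds (x := ω ^ 2)).sub (hω'.pow 2)).const_mul (μ₀ : ℂ)).norm
      rwa [sub_self, mul_zero, norm_zero] at h2
    have h3 := hθ0.max h1
    rwa [max_self] at h3
  set D := 2 * Real.exp (2 * M) with hD
  have hD0 : 0 ≤ D := by positivity
  have hb0 : Tendsto (fun i => 4 * η i * D ^ 3) l (𝓝 0) := by
    simpa using (hη0.const_mul 4).mul_const (D ^ 3)
  have hφ : ∀ x ∈ Icc x₀ (x₀ + 1), Tendsto (fun i => φ' i x) l (𝓝 (φ x)) := by
    intro x hx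
    refine tendsto_iff_norm_sub_tendsto_zero.2 (squeeze_zero' (by simp) ?_ hb0)
    filter_upwards [hε', hθ, hMω', hM'] with i h1 h2 h3 h4
    rw [norm_sub_rev]
    exact (IsSolution.norm_sub_le hε h1 hM0 hM h4 hMω h3
      (fun x => (h2 x).trans (le_max_left _ _)) (le_max_right _ _) h.left (h' i h1).left
      (by rw [h.left_u, (h' i h1).left_u]) (by rw [h.left_flux, (h' i h1).left_flux])
      (by simp [h.left_u]) (by simp [h.left_flux]) hx).1
  have hψ : ∀ x ∈ Icc x₀ (x₀ + 1), Tendsto (fun i => ψ' i x) l (𝓝 (ψ x)) := by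
    intro x hx
    refine tendsto_iff_norm_sub_tendsto_zero.2 (squeeze_zero' (by simp) ?_ hb0)
    filter_upwards [hε', hθ, hMω', hM'] with i h1 h2 h3 h4
    rw [norm_sub_rev]
    exact (IsSolution.norm_sub_le hε h1 hM0 hM h4 hMω h3
      (fun x => (h2 x).trans (le_max_left _ _)) (le_max_right _ _) h.right (h' i h1).right
      (by rw [h.right_u, (h' i h1).right_u]) (by rw [h.right_flux, (h' i h1).right_flux])
      (by simp [h.right_u]) (by simp [h.right_flux]) hx).1
  have hend : x₀ + 1 ∈ Icc x₀ (x₀ + 1) := ⟨by linarith, le_rfl⟩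
  obtain ⟨hlam, hr⟩ := hm.multiplier_root hε h
  -- The choice `Λ` need not be continuous: any root in the closed disc is close to `lam`, since
  -- only the limit has to lie strictly inside.
  have hΛt : Tendsto (fun i => Λ (φ' i (x₀ + 1))) l (𝓝 lam) := by
    have h1 : Tendsto (fun i => 2 * ‖φ' i (x₀ + 1) - φ (x₀ + 1)‖ / (1 - ‖lam‖)) l (𝓝 0) := by
      simpa using ((tendsto_iff_norm_sub_tendsto_zero.1 (hφ _ hend)).const_mul 2).div_const
        (1 - ‖lam‖)
    exact tendsto_iff_norm_sub_tendsto_zero.2 (squeeze_zero (fun _ => norm_nonneg _) (fun i =>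
      quadratic_root_dist_le (hΛ _) hlam (hΛle _) hm.norm_lt_one) h1)
  have hrt : Tendsto (fun i => ψ' i (x₀ + 1) / (Λ (φ' i (x₀ + 1)) - φ' i (x₀ + 1))) l (𝓝 r) := by
    rw [hr]
    exact (hψ _ hend).div (hΛt.sub (hφ _ hend)) (quadratic_root_ne hlam hm.norm_lt_one)
  refine ⟨fun i => Λ (φ' i (x₀ + 1)), _, fun i x =>
    ψ' i (x₀ + 1) / (Λ (φ' i (x₀ + 1)) - φ' i (x₀ + 1)) * φ' i x + 1 * ψ' i x, fun i x =>
    ψ' i (x₀ + 1) / (Λ (φ' i (x₀ + 1)) - φ' i (x₀ + 1)) * φf' i x + 1 * ψf' i x,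
    (‖r‖ + 1) * D + D, ?_, hΛt, hrt, fun x hx => ?_, ?_⟩
  · filter_upwards [hε', hΛt.norm.eventually_lt_const hm.norm_lt_one] with i h1 h2
    exact (h' i h1).isDecayingMode h1 (hΛ _) h2
  · have e := (h.eq_linComb hε.piecewiseSmooth hm.isSolution x).1
    rw [hm.u_eq, hm.flux_eq] at e
    rw [e]
    exact (hrt.mul (hφ x hx)).add ((hψ x hx).const_mul 1)
  · filter_upwards [hε', hMω', hM', hrt.norm.eventually_le_const (lt_add_one _)]
      with i h1 h2 h3 h4 x hx
    have b1 := ((h' i h1).left.norm_le h1 hM0 h3 h2 (by simp [(h' i h1).left_u])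
      (by simp [(h' i h1).left_flux]) hx).1
    have b2 := ((h' i h1).right.norm_le h1 hM0 h3 h2 (by simp [(h' i h1).right_u])
      (by simp [(h' i h1).right_flux]) hx).1
    rw [one_mul]
    refine (norm_add_le _ _).trans (add_le_add ?_ b2)
    rw [norm_mul]
    exact mul_le_mul h4 b1 (norm_nonneg _) (by positivity)

/-- The coupling `∫ u v` over the half-line, computed on one cell, for two functions multiplied by
`a` and `b` over each cell. -/
noncomputable def halfLineCoupling (x₀ : ℝ) (a b : ℂ) (u v : ℝ → ℂ) : ℂ :=
  (∫ x in x₀..x₀ + 1, u x * v x) / (1 - a * b)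

lemma one_sub_mul_ne_zero {a b : ℂ} (ha : ‖a‖ < 1) (hb : ‖b‖ < 1) : 1 - a * b ≠ 0 := by
  intro h0
  have h1 : ‖a‖ * ‖b‖ = 1 := by rw [← norm_mul, ← sub_eq_zero.1 h0, norm_one]
  nlinarith [norm_nonneg a, norm_nonneg b]

lemma tendsto_halfLineCoupling {ι κ : Type*} {l : Filter ι} {F : Filter κ}
    [F.IsCountablyGenerated] {lam' : ι → ℂ} {u' : ι → ℝ → ℂ} {C : ℝ} (hlt : ‖lam‖ < 1)
    (hu'c : ∀ᶠ i in l, Continuous (u' i))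
    (hlam : Tendsto lam' l (𝓝 lam))
    (hu : ∀ x ∈ Icc x₀ (x₀ + 1), Tendsto (fun i => u' i x) l (𝓝 (u x)))
    (hC : ∀ᶠ i in l, ∀ x ∈ Icc x₀ (x₀ + 1), ‖u' i x‖ ≤ C)
    {f g : κ → ι} (hf : Tendsto f F l) (hg : Tendsto g F l) :
    Tendsto (fun k => halfLineCoupling x₀ (lam' (f k)) (lam' (g k)) (u' (f k)) (u' (g k))) F
      (𝓝 (halfLineCoupling x₀ lam lam u u)) := by
  refine Tendsto.div ?_ (tendsto_const_nhds.sub ((hlam.comp hf).mul (hlam.comp hg)))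
    (one_sub_mul_ne_zero hlt hlt)
  have hIcc : ∀ x ∈ Set.uIoc x₀ (x₀ + 1), x ∈ Icc x₀ (x₀ + 1) := fun x hx => by
    rw [uIoc_of_le (by linarith)] at hx
    exact ⟨hx.1.le, hx.2⟩
  refine intervalIntegral.tendsto_integral_filter_of_dominated_convergence (fun _ => C * C) ?_ ?_
    intervalIntegrable_const (Filter.Eventually.of_forall fun x hx =>
      ((hu x (hIcc x hx)).comp hf).mul ((hu x (hIcc x hx)).comp hg))
  · filter_upwards [hf.eventually hu'c, hg.eventually hu'c] with k h1 h2
    exact (h1.mul h2).aestronglyMeasurable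
  · filter_upwards [hf.eventually hC, hg.eventually hC] with k h1 h2
    refine Filter.Eventually.of_forall fun x hx => ?_
    have h3 := h1 x (hIcc x hx)
    rw [norm_mul]
    exact mul_le_mul h3 (h2 x (hIcc x hx)) (norm_nonneg _) ((norm_nonneg _).trans h3)

/-- With unit fluxes the Wronskian at `x₀` is `r - r'`, and it is multiplied by `lam * lam'` over
one cell; its change there is the integral of `u v`. -/
lemma IsDecayingMode.sub_eq {ω' lam' r' : ℂ} {v q : ℝ → ℂ}
    (hm : IsDecayingMode μ₀ ε x₀ ω lam r u p) (hm' : IsDecayingMode μ₀ ε x₀ ω' lam' r' v q)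
    (hε : IsPermittivity x₀ ε) :
    r - r' = -(μ₀ * (ω ^ 2 - ω' ^ 2)) * halfLineCoupling x₀ lam lam' u v := by
  have h := IsSolution.wronskian_sub hε.piecewiseSmooth hε.piecewiseSmooth (M := 0) (by simp)
    hm.isSolution hm'.isSolution x₀ (x₀ + 1)
  simp only [sub_self, zero_mul, zero_add, intervalIntegral.integral_const_mul, hm.u_add_one,
    hm.flux_add_one, hm'.u_add_one, hm'.flux_add_one, hm.u_eq, hm'.u_eq, hm.flux_eq,
    hm'.flux_eq] at h
  have hne := one_sub_mul_ne_zero hm.norm_lt_one hm'.norm_lt_one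
  rw [halfLineCoupling, mul_div_assoc', eq_div_iff hne]
  linear_combination -h

lemma IsSolution.congr_sq {ω' : ℂ} (hu : IsSolution μ₀ ε ω u p) (h : ω ^ 2 = ω' ^ 2) :
    IsSolution μ₀ ε ω' u p :=
  ⟨hu.continuous_u, hu.continuous_flux, hu.hasDerivAt_u, h ▸ hu.hasDerivAt_flux⟩

open ComplexConjugate

lemma IsSolution.conjugate (hu : IsSolution μ₀ ε ω u p) (hreal : ∀ x, (ε x).im = 0) :
    IsSolution μ₀ ε (conj ω) (fun x => conj (u x)) (fun x => conj (p x)) where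
  continuous_u := Complex.continuous_conj.comp hu.continuous_u
  continuous_flux := Complex.continuous_conj.comp hu.continuous_flux
  hasDerivAt_u x hx := (hu.hasDerivAt_u x hx).star.congr_deriv (by
    simp [Complex.conj_eq_iff_im.2 (hreal x)])
  hasDerivAt_flux x := (hu.hasDerivAt_flux x).star.congr_deriv (by simp)

namespace IsDecayingMode

lemma conjugate (hm : IsDecayingMode μ₀ ε x₀ ω lam r u p) (hreal : ∀ x, (ε x).im = 0) :
    IsDecayingMode μ₀ ε x₀ (conj ω) (conj lam) (conj r) (fun x => conj (u x))
      (fun x => conj (p x)) where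
  isSolution := hm.isSolution.conjugate hreal
  u_eq := by rw [hm.u_eq]
  flux_eq := by rw [hm.flux_eq, map_one]
  u_add_one x := by rw [hm.u_add_one, map_mul]
  flux_add_one x := by rw [hm.flux_add_one, map_mul]
  norm_lt_one := by simpa using hm.norm_lt_one

lemma exists_halfLineCoupling_conj (hm : IsDecayingMode μ₀ ε x₀ ω lam r u p) :
    ∃ n : ℝ, 0 < n ∧
      halfLineCoupling x₀ lam (conj lam) u (fun x => conj (u x)) = (n : ℂ) := by
  have hpos : 0 < ∫ x in x₀..x₀ + 1, Complex.normSq (u x) := by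
    obtain ⟨x, hx, hux⟩ := hm.exists_ne_zero
    exact intervalIntegral.integral_pos (by linarith)
      (Complex.continuous_normSq.comp hm.isSolution.continuous_u).continuousOn
      (fun y _ => Complex.normSq_nonneg _) ⟨x, hx, Complex.normSq_pos.2 hux⟩
  have hl : 0 < 1 - Complex.normSq lam := by
    rw [Complex.normSq_eq_norm_sq]
    nlinarith [norm_nonneg lam, hm.norm_lt_one]
  refine ⟨_, div_pos hpos hl, ?_⟩
  simp only [halfLineCoupling, Complex.mul_conj, intervalIntegral.integral_ofReal]
  push_cast
  rfl

/-- When `ω²` is real, the conjugate mode solves the same equation with the same data at `x₀`. So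
`u` and `lam` are real and the coupling is that of `u` with its conjugate. -/
lemma exists_halfLineCoupling_self (hm : IsDecayingMode μ₀ ε x₀ ω lam r u p)
    (hε : IsPermittivity x₀ ε) (hreal : ∀ x, (ε x).im = 0) (hω : (starRingEnd ℂ ω) ^ 2 = ω ^ 2) :
    ∃ n : ℝ, 0 < n ∧ halfLineCoupling x₀ lam lam u u = (n : ℂ) := by
  have hc := hm.conjugate hreal
  have hr := hm.sub_eq hc hε
  rw [hω, sub_self, mul_zero, neg_zero, zero_mul] at hr
  obtain ⟨h1, h2⟩ := hm.isSolution.unique hε (hc.isSolution.congr_sq hω)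
    (by simpa [hm.u_eq] using sub_eq_zero.1 hr) (by simp [hm.flux_eq])
  have hlam : lam = starRingEnd ℂ lam := by
    have h3 := hm.flux_add_one x₀
    have h4 := hc.flux_add_one x₀
    rw [← congrFun h2, h3] at h4
    simpa [hm.flux_eq] using h4
  obtain ⟨n, hn, e⟩ := hm.exists_halfLineCoupling_conj
  rw [← hlam, ← h1] at e
  exact ⟨n, hn, e⟩

end IsDecayingMode

/-- The self-adjointness argument: adding the increments between each mode and its conjugate cancels
the impedances at a root, leaving `ω² - conj ω²` times a positive number. -/
lemma sq_conj_eq_of_root {εA εB : ℝ → ℂ} (hμ₀ : 0 < μ₀) (hA : IsPermittivity x₀ εA)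
    (hB : IsPermittivity x₀ εB) (hAr : ∀ x, (εA x).im = 0) (hBr : ∀ x, (εB x).im = 0)
    {lamA rA lamB rB : ℂ} {uA pA uB pB : ℝ → ℂ}
    (hmA : IsDecayingMode μ₀ εA x₀ ω lamA rA uA pA)
    (hmB : IsDecayingMode μ₀ εB x₀ ω lamB rB uB pB) (h0 : rA + rB = 0) :
    (conj ω) ^ 2 = ω ^ 2 := by
  obtain ⟨a, ha, hna⟩ := hmA.exists_halfLineCoupling_conj
  obtain ⟨b, hb, hnb⟩ := hmB.exists_halfLineCoupling_conj
  have h1 := hmA.sub_eq (hmA.conjugate hAr) hA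
  have h2 := hmB.sub_eq (hmB.conjugate hBr) hB
  rw [hna] at h1
  rw [hnb] at h2
  have h3 : conj rA + conj rB = 0 := by rw [← map_add, h0, map_zero]
  have h4 : ((μ₀ * (a + b) : ℝ) : ℂ) * ((conj ω) ^ 2 - ω ^ 2) = 0 := by
    push_cast
    linear_combination h0 - h3 - h1 - h2
  refine sub_eq_zero.1 ((mul_eq_zero.1 h4).resolve_left ?_)
  exact_mod_cast (mul_pos hμ₀ (add_pos ha hb)).ne'

end

/-! ### Roots of the damped impedance -/

/-- A quantitative inverse function theorem: existence of a root of an approximately linear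
function. -/
lemma exists_root_of_approx_linear {f : ℂ → ℂ} {z₀ L : ℂ} {ρ : ℝ} (hρ : 0 < ρ) (hL : L ≠ 0)
    (h : ∀ z ∈ Metric.ball z₀ ρ, ∀ w ∈ Metric.ball z₀ ρ,
      ‖f z - f w - L * (z - w)‖ ≤ ‖L‖ / 2 * ‖z - w‖)
    (h0 : ‖f z₀‖ ≤ ‖L‖ * ρ / 4) : ∃ z ∈ Metric.ball z₀ ρ, f z = 0 := by
  have hf : ApproximatesLinearOn f (L • ContinuousLinearMap.id ℂ ℂ) (Metric.ball z₀ ρ)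
      (‖L‖₊ / 2) := fun z hz w hw => by
    simpa using h z hz w hw
  let g : (L • ContinuousLinearMap.id ℂ ℂ).NonlinearRightInverse :=
    { toFun := fun y => L⁻¹ * y
      nnnorm := ‖L‖₊⁻¹
      bound' := fun y => by simp
      right_inv' := fun y => by simp [hL] }
  -- On the closed ball of radius `ρ/2` the image covers radius `(‖L‖ - ‖L‖/2) ρ/2`, whence the
  -- bound `‖L‖ρ/4`.
  have hs := hf.surjOn_closedBall_of_nonlinearRightInverse g (half_pos hρ).le
    (Metric.closedBall_subset_ball (half_lt_self hρ))
  obtain ⟨z, hz, hz0⟩ := hs (show (0 : ℂ) ∈ _ by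
    rw [Metric.mem_closedBall, dist_zero_left]
    refine h0.trans (le_of_eq ?_)
    simp [g]; ring)
  exact ⟨z, Metric.closedBall_subset_ball (half_lt_self hρ) hz, hz0⟩

lemma exists_uniform_bound_of_damping {εU : ℝ → ℂ} {εD : ℝ → ℝ → ℂ} {δ₀ : ℝ} (hδ₀ : 0 < δ₀)
    (hreal : ∀ x, (εU x).im = 0) (hre : ∀ δ ∈ Ioo 0 δ₀, ∀ x, (εD δ x).re = (εU x).re)
    (him : Tendsto (fun δ => ⨆ x : ℝ, ENNReal.ofReal |(εD δ x).im|) (𝓝[>] 0) (𝓝 0)) :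
    ∃ θ : ℝ → ℝ, Tendsto θ (𝓝[>] 0) (𝓝 0) ∧
      ∀ᶠ δ in 𝓝[>] (0 : ℝ), ∀ x, ‖εU x - εD δ x‖ ≤ θ δ := by
  refine ⟨fun δ => (⨆ x : ℝ, ENNReal.ofReal |(εD δ x).im|).toReal,
    (ENNReal.tendsto_toReal ENNReal.zero_ne_top).comp him, ?_⟩
  filter_upwards [Ioo_mem_nhdsGT hδ₀, him.eventually_lt_const ENNReal.zero_lt_top] with δ hδ hlt x
  have h1 : εU x - εD δ x = ((-(εD δ x).im : ℝ) : ℂ) * Complex.I := by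
    apply Complex.ext <;> simp [hre δ hδ x, hreal x]
  rw [h1, norm_mul, Complex.norm_I, mul_one, Complex.norm_real, norm_neg, Real.norm_eq_abs]
  exact (ENNReal.ofReal_le_iff_le_toReal hlt.ne).1
    (le_iSup (fun x : ℝ => ENNReal.ofReal |(εD δ x).im|) x)

/-- The surface impedance `r` of a damped material near a real squared frequency of a band gap of
the undamped material: its difference quotient in the squared frequency has a negative limit. -/
lemma IsDecayingMode.exists_damped {μ₀ x₀ δ₀ : ℝ} (hδ₀ : 0 < δ₀) {εU : ℝ → ℂ}
    {εD : ℝ → ℝ → ℂ} (hU : IsPermittivity x₀ εU) (hreal : ∀ x, (εU x).im = 0)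
    (hD : ∀ δ ∈ Ioo 0 δ₀, IsPermittivity x₀ (εD δ))
    (hre : ∀ δ ∈ Ioo 0 δ₀, ∀ x, (εD δ x).re = (εU x).re)
    (him : Tendsto (fun δ => ⨆ x : ℝ, ENNReal.ofReal |(εD δ x).im|) (𝓝[>] 0) (𝓝 0))
    {ωU lamU rU : ℂ} {uU pU : ℝ → ℂ} (hm : IsDecayingMode μ₀ εU x₀ ωU lamU rU uU pU)
    (hω : (starRingEnd ℂ ωU) ^ 2 = ωU ^ 2) :
    ∃ (lam r : ℝ × ℂ → ℂ) (u p : ℝ × ℂ → ℝ → ℂ) (K : ℝ × ℂ × ℂ → ℂ) (n : ℝ), 0 < n ∧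
      (∀ᶠ i in 𝓝[>] (0 : ℝ) ×ˢ 𝓝 ωU,
        IsDecayingMode μ₀ (εD i.1) x₀ i.2 (lam i) (r i) (u i) (p i)) ∧
      Tendsto r (𝓝[>] (0 : ℝ) ×ˢ 𝓝 ωU) (𝓝 rU) ∧
      Tendsto K (𝓝[>] (0 : ℝ) ×ˢ 𝓝 ωU ×ˢ 𝓝 ωU) (𝓝 (n : ℂ)) ∧
      ∀ᶠ k in 𝓝[>] (0 : ℝ) ×ˢ 𝓝 ωU ×ˢ 𝓝 ωU, r (k.1, k.2.1) - r (k.1, k.2.2) =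
        -(μ₀ * (k.2.1 ^ 2 - k.2.2 ^ 2)) * K k := by
  obtain ⟨θ, hθ0, hθ⟩ := exists_uniform_bound_of_damping hδ₀ hreal hre him
  have hDe : ∀ᶠ δ in 𝓝[>] (0 : ℝ), IsPermittivity x₀ (εD δ) := by
    filter_upwards [Ioo_mem_nhdsGT hδ₀] with δ hδ using hD δ hδ
  have hfst : Tendsto Prod.fst (𝓝[>] (0 : ℝ) ×ˢ 𝓝 ωU) (𝓝[>] (0 : ℝ)) := tendsto_fst
  obtain ⟨lam, r, u, p, C, hmode, hlam, hr, hu, hC⟩ := hm.exists_perturbation hU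
    (ε' := fun i : ℝ × ℂ => εD i.1) (ω' := fun i => i.2) (θ := fun i => θ i.1)
    (hfst.eventually hDe) (hfst.eventually hθ) (hθ0.comp hfst) tendsto_snd
  obtain ⟨n, hn, hnU⟩ := hm.exists_halfLineCoupling_self hU hreal hω
  have hf : Tendsto (fun k : ℝ × ℂ × ℂ => (k.1, k.2.1)) (𝓝[>] (0 : ℝ) ×ˢ 𝓝 ωU ×ˢ 𝓝 ωU)
      (𝓝[>] (0 : ℝ) ×ˢ 𝓝 ωU) := tendsto_fst.prodMk (tendsto_fst.comp tendsto_snd)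
  have hg : Tendsto (fun k : ℝ × ℂ × ℂ => (k.1, k.2.2)) (𝓝[>] (0 : ℝ) ×ˢ 𝓝 ωU ×ˢ 𝓝 ωU)
      (𝓝[>] (0 : ℝ) ×ˢ 𝓝 ωU) := tendsto_fst.prodMk (tendsto_snd.comp tendsto_snd)
  refine ⟨lam, r, u, p, _, n, hn, hmode, hr, hnU ▸ tendsto_halfLineCoupling hm.norm_lt_one
    (hmode.mono fun i hi => hi.isSolution.continuous_u) hlam hu hC hf hg, ?_⟩
  filter_upwards [hf.eventually hmode, hg.eventually hmode, tendsto_fst.eventually hDe]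
    with k h1 h2 h3
  exact h1.sub_eq h2 h3

end DampedInterface

open DampedInterface in
theorem theorem6p5
    (μ₀ : ℝ) (hμ₀ : 0 < μ₀) (x₀ : ℝ)
    -- the undamped materials
    (εAU εBU : ℝ → ℂ)
    (hAU : DampedInterface.IsPermittivity x₀ εAU) (hBU : DampedInterface.IsPermittivity x₀ εBU)
    (hAU_real : ∀ x, (εAU x).im = 0) (hBU_real : ∀ x, (εBU x).im = 0)
    -- the damped materials, for small values of the damping parameter
    (δ₀ : ℝ) (hδ₀ : 0 < δ₀) (εAD εBD : ℝ → ℝ → ℂ)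
    (hAD : ∀ δ ∈ Set.Ioo 0 δ₀, DampedInterface.IsPermittivity x₀ (εAD δ))
    (hBD : ∀ δ ∈ Set.Ioo 0 δ₀, DampedInterface.IsPermittivity x₀ (εBD δ))
    (hAD_re : ∀ δ ∈ Set.Ioo 0 δ₀, ∀ x, (εAD δ x).re = (εAU x).re)
    (hBD_re : ∀ δ ∈ Set.Ioo 0 δ₀, ∀ x, (εBD δ x).re = (εBU x).re)
    (hAD_im : Filter.Tendsto (fun δ => ⨆ x : ℝ, ENNReal.ofReal |(εAD δ x).im|)
      (nhdsWithin 0 (Set.Ioi 0)) (nhds 0))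
    (hBD_im : Filter.Tendsto (fun δ => ⨆ x : ℝ, ENNReal.ofReal |(εBD δ x).im|)
      (nhdsWithin 0 (Set.Ioi 0)) (nhds 0))
    -- a root of the undamped interface impedance in the undamped band gap
    (ωU : ℂ) (hωU : ωU ∈ DampedInterface.commonGap μ₀ εAU εBU)
    (hroot : DampedInterface.interfaceImpedance μ₀ εAU εBU x₀ ωU = ((0 : ℂ) : OnePoint ℂ)) :
    ∃ ρ > 0, ∃ ωD : ℝ → ℂ,
      Filter.Tendsto ωD (nhdsWithin 0 (Set.Ioi 0)) (nhds ωU) ∧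
      ∀ᶠ δ in nhdsWithin (0 : ℝ) (Set.Ioi 0),
        ωD δ ∈ connectedComponentIn (DampedInterface.commonGap μ₀ (εAD δ) (εBD δ)) ωU ∧
        DampedInterface.interfaceImpedance μ₀ (εAD δ) (εBD δ) x₀ (ωD δ) = ((0 : ℂ) : OnePoint ℂ) ∧
        ∀ ω ∈ DampedInterface.commonGap μ₀ (εAD δ) (εBD δ), dist ω ωU < ρ →
          DampedInterface.interfaceImpedance μ₀ (εAD δ) (εBD δ) x₀ ω = ((0 : ℂ) : OnePoint ℂ) →
          ω = ωD δ := by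
  obtain ⟨lamA, rA, uA, pA, hmA⟩ := exists_isDecayingMode hAU hωU.1
  obtain ⟨lamB, rB, uB, pB, hmB⟩ := exists_isDecayingMode hBU hωU.2
  rw [interfaceImpedance_eq hAU hBU hmA hmB, OnePoint.coe_eq_coe] at hroot
  have hsq := sq_conj_eq_of_root hμ₀ hAU hBU hAU_real hBU_real hmA hmB hroot
  obtain ⟨lA, sA, vA, qA, KA, nA, hnA, hmodeA, hsA, hKA, hdA⟩ :=
    hmA.exists_damped hδ₀ hAU hAU_real hAD hAD_re hAD_im hsq
  obtain ⟨lB, sB, vB, qB, KB, nB, hnB, hmodeB, hsB, hKB, hdB⟩ :=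
    hmB.exists_damped hδ₀ hBU hBU_real hBD hBD_re hBD_im hsq
  set L : ℂ := -(μ₀ * (ωU + ωU)) * (nA + nB) with hLdef
  have hL : L ≠ 0 := by
    have h1 : ((nA : ℂ) + nB) ≠ 0 := by exact_mod_cast (add_pos hnA hnB).ne'
    have h2 : (μ₀ : ℂ) ≠ 0 := by exact_mod_cast hμ₀.ne'
    have h3 : ωU + ωU ≠ 0 := by
      rw [← two_mul]; exact mul_ne_zero two_ne_zero hmA.omega_ne_zero
    exact mul_ne_zero (neg_ne_zero.2 (mul_ne_zero h2 h3)) h1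
  have hLpos : 0 < ‖L‖ := norm_pos_iff.2 hL
  -- the difference quotients of the damped impedances are close to `L`
  have hG : Tendsto (fun k : ℝ × ℂ × ℂ => -(μ₀ * (k.2.1 + k.2.2)) * (KA k + KB k))
      (𝓝[>] (0 : ℝ) ×ˢ 𝓝 ωU ×ˢ 𝓝 ωU) (𝓝 L) :=
    (((tendsto_fst.comp tendsto_snd).add (tendsto_snd.comp tendsto_snd)).const_mul
      (μ₀ : ℂ)).neg.mul (hKA.add hKB)
  have hquot : ∀ᶠ k in 𝓝[>] (0 : ℝ) ×ˢ 𝓝 ωU ×ˢ 𝓝 ωU,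
      ‖sA (k.1, k.2.1) + sB (k.1, k.2.1) - (sA (k.1, k.2.2) + sB (k.1, k.2.2))
        - L * (k.2.1 - k.2.2)‖ ≤ ‖L‖ / 2 * ‖k.2.1 - k.2.2‖ := by
    have h0 := (tendsto_iff_norm_sub_tendsto_zero.1 hG).eventually_le_const (half_pos hLpos)
    filter_upwards [h0, hdA, hdB] with k h1 h2 h3
    refine le_trans (le_of_eq ?_) (mul_le_mul_of_nonneg_right h1 (norm_nonneg _))
    rw [← norm_mul]
    congr 1
    linear_combination h2 + h3
  -- Separating the smallness of `δ` from the closeness of the frequencies makes the radius `ρ`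
  -- independent of `δ`.
  obtain ⟨P, hP, Q, hQ, hPQ⟩ := eventually_prod_iff.1 hquot
  obtain ⟨P', hP', Q', hQ', hPQ'⟩ := eventually_prod_iff.1 (hmodeA.and hmodeB)
  rw [← nhds_prod_eq, Metric.eventually_nhds_iff_ball] at hQ
  obtain ⟨ρ₁, hρ₁, hQ⟩ := hQ
  obtain ⟨ρ₂, hρ₂, hQ'⟩ := Metric.eventually_nhds_iff_ball.1 hQ'
  set ρ := min ρ₁ ρ₂ with hρdef
  have hρ : 0 < ρ := lt_min hρ₁ hρ₂
  have hdiag : Tendsto (fun δ : ℝ => (δ, ωU)) (𝓝[>] 0) (𝓝[>] (0 : ℝ) ×ˢ 𝓝 ωU) :=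
    tendsto_id.prodMk tendsto_const_nhds
  have hZ0 : Tendsto (fun δ : ℝ => ‖sA (δ, ωU) + sB (δ, ωU)‖) (𝓝[>] 0) (𝓝 0) := by
    simpa [hroot] using ((hsA.add hsB).comp hdiag).norm
  have hlin : ∀ δ, P δ → ∀ z ∈ Metric.ball ωU ρ, ∀ w ∈ Metric.ball ωU ρ,
      ‖sA (δ, z) + sB (δ, z) - (sA (δ, w) + sB (δ, w)) - L * (z - w)‖ ≤ ‖L‖ / 2 * ‖z - w‖ := by
    intro δ hδ z hz w hw
    refine hPQ hδ (hQ (z, w) ?_)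
    rw [← ball_prod_same]
    exact ⟨Metric.ball_subset_ball (min_le_left _ _) hz,
      Metric.ball_subset_ball (min_le_left _ _) hw⟩
  -- the values of the impedance control the distances
  have hexpand : ∀ δ, P δ → ∀ z ∈ Metric.ball ωU ρ, ∀ w ∈ Metric.ball ωU ρ,
      ‖L‖ / 2 * ‖z - w‖ ≤ ‖sA (δ, z) + sB (δ, z) - (sA (δ, w) + sB (δ, w))‖ := by
    intro δ hδ z hz w hw
    have h1 := hlin δ hδ z hz w hw
    have h2 := norm_sub_norm_le (L * (z - w)) (sA (δ, z) + sB (δ, z) - (sA (δ, w) + sB (δ, w)))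
    rw [norm_mul, norm_sub_rev (L * (z - w))] at h2
    linarith
  have hex : ∀ δ, ∃ z, (P δ ∧ ‖sA (δ, ωU) + sB (δ, ωU)‖ ≤ ‖L‖ * ρ / 4) →
      z ∈ Metric.ball ωU ρ ∧ sA (δ, z) + sB (δ, z) = 0 := by
    intro δ
    by_cases h : P δ ∧ ‖sA (δ, ωU) + sB (δ, ωU)‖ ≤ ‖L‖ * ρ / 4
    · obtain ⟨z, hz, hz0⟩ := exists_root_of_approx_linear (f := fun z => sA (δ, z) + sB (δ, z))
        hρ hL (hlin δ h.1) h.2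
      exact ⟨z, fun _ => ⟨hz, hz0⟩⟩
    · exact ⟨0, fun h' => absurd h' h⟩
  choose ωD hωD using hex
  have hsmall : ∀ᶠ δ in 𝓝[>] (0 : ℝ), ‖sA (δ, ωU) + sB (δ, ωU)‖ ≤ ‖L‖ * ρ / 4 :=
    hZ0.eventually_le_const (by positivity)
  refine ⟨ρ, hρ, ωD, ?_, ?_⟩
  · have hb : Tendsto (fun δ : ℝ => ‖sA (δ, ωU) + sB (δ, ωU)‖ / (‖L‖ / 2)) (𝓝[>] 0) (𝓝 0) := by
      simpa using hZ0.div_const (‖L‖ / 2)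
    refine tendsto_iff_norm_sub_tendsto_zero.2
      (squeeze_zero' (Eventually.of_forall fun _ => norm_nonneg _) ?_ hb)
    filter_upwards [hP, hsmall] with δ h1 h2
    obtain ⟨h3, h4⟩ := hωD δ ⟨h1, h2⟩
    have h5 := hexpand δ h1 _ h3 _ (Metric.mem_ball_self hρ)
    rw [h4, zero_sub, norm_neg] at h5
    rw [le_div_iff₀ (half_pos hLpos)]
    linarith
  · filter_upwards [hP, hP', hsmall, Ioo_mem_nhdsGT hδ₀] with δ h1 h1' h2 hδ
    obtain ⟨h3, h4⟩ := hωD δ ⟨h1, h2⟩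
    have hmode := fun z (hz : z ∈ Metric.ball ωU ρ) =>
      hPQ' h1' (hQ' z (Metric.ball_subset_ball (min_le_right _ _) hz))
    have hZ := fun z hz =>
      interfaceImpedance_eq (hAD δ hδ) (hBD δ hδ) (hmode z hz).1 (hmode z hz).2
    refine ⟨?_, ?_, fun ω _ hω hω0 => ?_⟩
    -- The whole ball carries decaying modes of both damped materials, hence is a connected part of
    -- the gap containing both `ωU` and the root.
    · refine (convex_ball ωU ρ).isPreconnected.subset_connectedComponentIn
        (Metric.mem_ball_self hρ) (fun z hz => ?_) h3
      exact ⟨(hmode z hz).1.not_mem_blochSpectrum (hAD δ hδ),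
        (hmode z hz).2.not_mem_blochSpectrum (hBD δ hδ)⟩
    · rw [hZ _ h3]
      exact congrArg _ h4
    · rw [hZ ω hω, OnePoint.coe_eq_coe] at hω0
      have h5 := hexpand δ h1 ω hω _ h3
      rw [h4, sub_zero, hω0, norm_zero] at h5
      have h6 : ‖ω - ωD δ‖ ≤ 0 := by
        by_contra! h7
        exact absurd h5 (not_le.2 (mul_pos (half_pos hLpos) h7))
      exact sub_eq_zero.1 (norm_le_zero_iff.1 h6)
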